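/- Let $n\ge 0$ be an integer. Let $\mathcal D(\mathbb R^n)$ be the space of compactly supported smooth functions and $\mathcal D'(\mathbb R^n)$ the space of (complex-valued) distributions; for $h\in\mathbb R^n$ write $T_{h}f=f(\,\cdot\,-h)$, that is, $\langle T_{h}f,\varphi\rangle=\langle f,T_{-h}\varphi\rangle$. Let $\mathcal K_1(\mathbb R^n)$ be the space of all $\varphi\in C^\infty(\mathbb R^n)$ such that $\nu_k(\varphi)=\sup_{t\in\mathbb R^n,\,|\alpha|\le k}e^{k|t|}|\varphi^{(\alpha)}(t)|<\infty$ for every $k\in\mathbb N_0$, with the topology given by the norms $\nu_k$, and let $\mathcal K_1'(\mathbb R^n)$ be its dual. An exponentially moderate weight is a measurable function $\omega:\mathbb R^n\to(0,\infty)$ such that, for some constants $A>0$ and $a\ge 0$, $\omega(x+y)\le A\,\omega(y)e^{a|x|}$ for all $x,y\in\mathbb R^n$. For such $\omega$ let $\mathcal D_{L^1_\omega}(\mathbb R^n)$ be the space of all $\varphi\in C^\infty(\mathbb R^n)$ such that $\int_{\mathbb R^n}|\varphi^{(\alpha)}(t)|\,\omega(t)\,dt<\infty$ for all $\alpha\in\mathbb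 N_0^n$, with the topology given by the norms $\|\varphi\|_{1,\omega,k}=\sup_{|\alpha|\le k}\int_{\mathbb R^n}|\varphi^{(\alpha)}(t)|\,\omega(t)\,dt$, $k\in\mathbb N_0$. Let $\mathcal B'_\omega(\mathbb R^n)$ be the strong dual of $\mathcal D_{L^1_\omega}(\mathbb R^n)$, and let $\dot{\mathcal B}'_\omega(\mathbb R^n)$ be the closure of $\mathcal D(\mathbb R^n)$ in $\mathcal B'_\omega(\mathbb R^n)$, where $\phi\in\mathcal D(\mathbb R^n)$ is identified with the functional $\chi\mapsto\int_{\mathbb R^n}\phi(t)\chi(t)\,dt$. The spaces $\mathcal K_1'(\mathbb R^n)$, $\mathcal B'_\omega(\mathbb R^n)$ and $\dot{\mathcal B}'_\omega(\mathbb R^n)$ are regarded as subsets of $\mathcal D'(\mathbb R^n)$ by restricting functionals to $\mathcal D(\mathbb R^n)$. Then $$\mathcal K_1'(\mathbb R^n)=\bigcup_\omega\mathcal B'_\omega(\mathbb R^n)=\bigcup_\omega\dot{\mathcal B}'_\omega(\mathbb R^n),$$ where the unions are taken over all exponentially moderate weights $\omega$. Moreover, a distribution $f\in\mathcal D'(\mathbb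 R^n)$ belongs to $\mathcal K_1'(\mathbb R^n)$ if and only if there is $s\in\mathbb R$ such that the set $\{e^{-s|h|}T_{-h}f:\ h\in\mathbb R^n\}$ is bounded in $\mathcal D'(\mathbb R^n)$. -/

import Mathlib

open MeasureTheory TopologicalSpace Bornology
open scoped Distributions

namespace ExpType

/-- The Euclidean space `ℝⁿ`. -/
abbrev Rn (n : ℕ) : Type := EuclideanSpace ℝ (Fin n)

/-! ### The test function space `K₁(ℝⁿ)` -/

/-- The exponentially rapidly decreasing smooth functions, as a complex vector space: those
`φ ∈ C^∞(ℝⁿ)` such that `e^{k|t|} |D^j φ(t)|` is bounded in `t` for all `k` and `j`. Here `D^j φ(t)`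
is the `j`-th Fréchet derivative, whose norm is comparable with `max_{|α| = j} |φ^{(α)}(t)|`. -/
noncomputable def K1Submodule (n : ℕ) : Submodule ℂ (Rn n → ℂ) where
  carrier := {φ | ContDiff ℝ (⊤ : ℕ∞) φ ∧ ∀ k j : ℕ, ∃ C : ℝ, ∀ t : Rn n,
    Real.exp (k * ‖t‖) * ‖iteratedFDeriv ℝ j φ t‖ ≤ C}
  zero_mem' := by
    refine ⟨contDiff_const, fun k j => ⟨0, fun t => ?_⟩⟩
    have h : iteratedFDeriv ℝ j (0 : Rn n → ℂ) = 0 := iteratedFDeriv_fun_zero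
    simp [h]
  add_mem' := by
    rintro f g ⟨hf, hf'⟩ ⟨hg, hg'⟩
    refine ⟨hf.add hg, fun k j => ?_⟩
    obtain ⟨C, hC⟩ := hf' k j
    obtain ⟨D, hD⟩ := hg' k j
    refine ⟨C + D, fun t => ?_⟩
    rw [iteratedFDeriv_add_apply (hf.of_le (mod_cast le_top)).contDiffAt
      (hg.of_le (mod_cast le_top)).contDiffAt]
    calc _ ≤ Real.exp (k * ‖t‖) * (‖iteratedFDeriv ℝ j f t‖ + ‖iteratedFDeriv ℝ j g t‖) := by
          gcongr; exact norm_add_le _ _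
      _ ≤ C + D := by rw [mul_add]; exact add_le_add (hC t) (hD t)
  smul_mem' := by
    rintro c f ⟨hf, hf'⟩
    refine ⟨hf.const_smul c, fun k j => ?_⟩
    obtain ⟨C, hC⟩ := hf' k j
    refine ⟨‖c‖ * C, fun t => ?_⟩
    rw [iteratedFDeriv_const_smul_apply (hf.of_le (mod_cast le_top)).contDiffAt, norm_smul,
      mul_left_comm]
    exact mul_le_mul_of_nonneg_left (hC t) (norm_nonneg c)

/-- The space `K₁(ℝⁿ)`. This is a type of its own and not the coercion of the submodule, because it
does not carry the topology of pointwise convergence. -/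
def K1 (n : ℕ) : Type := K1Submodule n

namespace K1

variable {n : ℕ}

noncomputable instance : AddCommGroup (K1 n) := inferInstanceAs (AddCommGroup (K1Submodule n))

noncomputable instance : Module ℂ (K1 n) := inferInstanceAs (Module ℂ (K1Submodule n))

instance : CoeFun (K1 n) fun _ => Rn n → ℂ := ⟨fun φ => φ.1⟩

/-- The seminorm `φ ↦ sup_t e^{k|t|} |D^j φ(t)|`. -/
noncomputable def weightedSup (n k j : ℕ) : Seminorm ℂ (K1 n) :=
  have bdd (φ : K1 n) : BddAbove
      (Set.range fun t : Rn n => Real.exp (k * ‖t‖) * ‖iteratedFDeriv ℝ j φ t‖) := by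
    obtain ⟨C, hC⟩ := φ.2.2 k j
    exact ⟨C, by rintro _ ⟨t, rfl⟩; exact hC t⟩
  Seminorm.of (fun φ => ⨆ t : Rn n, Real.exp (k * ‖t‖) * ‖iteratedFDeriv ℝ j φ t‖)
    (fun φ χ => by
      refine ciSup_le fun t => ?_
      have h : iteratedFDeriv ℝ j (φ + χ : K1 n) t
          = iteratedFDeriv ℝ j φ t + iteratedFDeriv ℝ j χ t :=
        iteratedFDeriv_add_apply (φ.2.1.of_le (mod_cast le_top)).contDiffAt
          (χ.2.1.of_le (mod_cast le_top)).contDiffAt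
      calc Real.exp (k * ‖t‖) * ‖iteratedFDeriv ℝ j (φ + χ : K1 n) t‖
          ≤ Real.exp (k * ‖t‖) * (‖iteratedFDeriv ℝ j φ t‖ + ‖iteratedFDeriv ℝ j χ t‖) := by
            rw [h]; gcongr; exact norm_add_le _ _
        _ ≤ _ := by
            rw [mul_add]
            exact add_le_add (le_ciSup (bdd φ) t) (le_ciSup (bdd χ) t))
    (fun c φ => by
      rw [Real.mul_iSup_of_nonneg (norm_nonneg c)]
      refine iSup_congr fun t => ?_
      have h : iteratedFDeriv ℝ j (c • φ : K1 n) t = c • iteratedFDeriv ℝ j φ t :=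
        iteratedFDeriv_const_smul_apply (φ.2.1.of_le (mod_cast le_top)).contDiffAt
      rw [h, norm_smul, mul_left_comm])

/-- The norms `ν_k(φ) = sup_{t, j ≤ k} e^{k|t|} |D^j φ(t)|`. -/
noncomputable def nu (n : ℕ) : SeminormFamily ℂ (K1 n) ℕ :=
  fun k => (Finset.range (k + 1)).sup fun j => weightedSup n k j

/-- The Fréchet topology of `K₁(ℝⁿ)`, generated by the norms `ν_k`. -/
noncomputable instance : TopologicalSpace (K1 n) := (nu n).moduleFilterBasis.topology

theorem withSeminorms (n : ℕ) : WithSeminorms (nu n) := ⟨rfl⟩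

/-- A real test function, regarded as an element of `K₁(ℝⁿ)`. -/
noncomputable def ofTest (φ : 𝓓((⊤ : Opens (Rn n)), ℝ)) : K1 n :=
  ⟨fun t => (φ t : ℂ), by
    have h1 : ContDiff ℝ (⊤ : ℕ∞) fun t => (φ t : ℂ) := Complex.ofRealCLM.contDiff.comp φ.contDiff
    have h2 : HasCompactSupport fun t => (φ t : ℂ) :=
      φ.hasCompactSupport.comp_left Complex.ofReal_zero
    refine ⟨h1, fun k j => ?_⟩
    have h3 : Continuous (iteratedFDeriv ℝ j fun t => (φ t : ℂ)) :=
      h1.continuous_iteratedFDeriv (mod_cast le_top)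
    obtain ⟨C, hC⟩ := ((h2.iteratedFDeriv (𝕜 := ℝ) j).norm.mul_left
      (f := fun t : Rn n => Real.exp (k * ‖t‖))).exists_bound_of_continuous (by fun_prop)
    exact ⟨C, fun t => (le_abs_self _).trans (hC t)⟩⟩

end K1

/-! ### Exponentially moderate weights and the spaces `D_{L¹_ω}(ℝⁿ)` -/

/-- An exponentially moderate weight on `ℝⁿ`: a measurable function `ω : ℝⁿ → (0, ∞)` with
`ω(x + y) ≤ A ω(y) e^{a|x|}` for some constants `A > 0` and `a ≥ 0`. -/
structure Weight (n : ℕ) where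
  toFun : Rn n → ℝ
  measurable' : Measurable toFun
  pos' : ∀ x, 0 < toFun x
  moderate' : ∃ A a : ℝ, 0 < A ∧ 0 ≤ a ∧
    ∀ x y, toFun (x + y) ≤ A * toFun y * Real.exp (a * ‖x‖)

instance (n : ℕ) : CoeFun (Weight n) fun _ => Rn n → ℝ := ⟨Weight.toFun⟩

/-- The measure `ω(t) dt`, so that `L¹_ω` is `L¹` of this measure. -/
noncomputable def Weight.measure {n : ℕ} (ω : Weight n) : Measure (Rn n) :=
  volume.withDensity fun t => ENNReal.ofReal (ω t)

theorem Weight.isLocallyFiniteMeasure {n : ℕ} (ω : Weight n) :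
    IsLocallyFiniteMeasure ω.measure := by
  obtain ⟨A, a, -, -, h⟩ := ω.moderate'
  have h1 : IsLocallyFiniteMeasure ((volume : Measure (Rn n)).withDensity
      fun t => ENNReal.ofReal (A * ω 0 * Real.exp (a * ‖t‖))) :=
    IsLocallyFiniteMeasure.withDensity_ofReal (by fun_prop)
  have h2 : ω.measure ≤ (volume : Measure (Rn n)).withDensity
      fun t => ENNReal.ofReal (A * ω 0 * Real.exp (a * ‖t‖)) :=
    withDensity_mono (ae_of_all _ fun t => ENNReal.ofReal_le_ofReal (by simpa using h t 0))
  exact Measure.isLocallyFiniteMeasure_of_le h2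

/-- The smooth functions all of whose derivatives belong to `L¹_ω`, as a complex vector space. -/
noncomputable def DL1Submodule {n : ℕ} (ω : Weight n) : Submodule ℂ (Rn n → ℂ) where
  carrier := {φ | ContDiff ℝ (⊤ : ℕ∞) φ ∧ ∀ j : ℕ, Integrable (iteratedFDeriv ℝ j φ) ω.measure}
  zero_mem' := by
    refine ⟨contDiff_const, fun j => ?_⟩
    have h : iteratedFDeriv ℝ j (0 : Rn n → ℂ) = 0 := iteratedFDeriv_fun_zero
    rw [h]
    exact integrable_zero _ _ _
  add_mem' := by
    rintro f g ⟨hf, hf'⟩ ⟨hg, hg'⟩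
    refine ⟨hf.add hg, fun j => ?_⟩
    rw [iteratedFDeriv_add (hf.of_le (mod_cast le_top)) (hg.of_le (mod_cast le_top))]
    exact (hf' j).add (hg' j)
  smul_mem' := by
    rintro c f ⟨hf, hf'⟩
    refine ⟨hf.const_smul c, fun j => ?_⟩
    have h : iteratedFDeriv ℝ j (c • f) = c • iteratedFDeriv ℝ j f := by
      ext1 t
      exact iteratedFDeriv_const_smul_apply (hf.of_le (mod_cast le_top)).contDiffAt
    rw [h]
    exact (hf' j).smul c

/-- The space `D_{L¹_ω}(ℝⁿ)`. -/
def DL1 {n : ℕ} (ω : Weight n) : Type := DL1Submodule ω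

namespace DL1

variable {n : ℕ} {ω : Weight n}

noncomputable instance : AddCommGroup (DL1 ω) := inferInstanceAs (AddCommGroup (DL1Submodule ω))

noncomputable instance : Module ℂ (DL1 ω) := inferInstanceAs (Module ℂ (DL1Submodule ω))

instance : CoeFun (DL1 ω) fun _ => Rn n → ℂ := ⟨fun φ => φ.1⟩

/-- The seminorm `φ ↦ ∫ |D^j φ(t)| ω(t) dt`. -/
noncomputable def weightedInt (ω : Weight n) (j : ℕ) : Seminorm ℂ (DL1 ω) :=
  Seminorm.of (fun φ => ∫ t, ‖iteratedFDeriv ℝ j φ t‖ ∂ω.measure)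
    (fun φ χ => by
      rw [← integral_add (φ.2.2 j).norm (χ.2.2 j).norm]
      refine integral_mono ((φ + χ : DL1 ω).2.2 j).norm
        ((φ.2.2 j).norm.add (χ.2.2 j).norm) fun t => ?_
      have h : iteratedFDeriv ℝ j (φ + χ : DL1 ω) t
          = iteratedFDeriv ℝ j φ t + iteratedFDeriv ℝ j χ t :=
        iteratedFDeriv_add_apply (φ.2.1.of_le (mod_cast le_top)).contDiffAt
          (χ.2.1.of_le (mod_cast le_top)).contDiffAt
      change ‖iteratedFDeriv ℝ j (φ + χ : DL1 ω) t‖ ≤ _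
      rw [h]
      exact norm_add_le _ _)
    (fun c φ => by
      rw [← integral_const_mul]
      refine integral_congr_ae (ae_of_all _ fun t => ?_)
      have h : iteratedFDeriv ℝ j (c • φ : DL1 ω) t = c • iteratedFDeriv ℝ j φ t :=
        iteratedFDeriv_const_smul_apply (φ.2.1.of_le (mod_cast le_top)).contDiffAt
      change ‖iteratedFDeriv ℝ j (c • φ : DL1 ω) t‖ = _
      rw [h, norm_smul])

/-- The norms `‖φ‖_{1,ω,k} = sup_{j ≤ k} ∫ |D^j φ(t)| ω(t) dt`. -/
noncomputable def norms (ω : Weight n) : SeminormFamily ℂ (DL1 ω) ℕ :=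
  fun k => (Finset.range (k + 1)).sup fun j => weightedInt ω j

/-- The Fréchet topology of `D_{L¹_ω}(ℝⁿ)`, generated by the norms `‖·‖_{1,ω,k}`. -/
noncomputable instance : TopologicalSpace (DL1 ω) := (norms ω).moduleFilterBasis.topology

theorem withSeminorms (ω : Weight n) : WithSeminorms (norms ω) := ⟨rfl⟩

/-- A real test function, regarded as an element of `D_{L¹_ω}(ℝⁿ)`. -/
noncomputable def ofTest (ω : Weight n) (φ : 𝓓((⊤ : Opens (Rn n)), ℝ)) : DL1 ω :=
  ⟨fun t => (φ t : ℂ), by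
    have h1 : ContDiff ℝ (⊤ : ℕ∞) fun t => (φ t : ℂ) := Complex.ofRealCLM.contDiff.comp φ.contDiff
    have h2 : HasCompactSupport fun t => (φ t : ℂ) :=
      φ.hasCompactSupport.comp_left Complex.ofReal_zero
    have := ω.isLocallyFiniteMeasure
    exact ⟨h1, fun j => (h1.continuous_iteratedFDeriv
      (mod_cast le_top)).integrable_of_hasCompactSupport (h2.iteratedFDeriv (𝕜 := ℝ) j)⟩⟩

end DL1

/-! ### The distribution spaces

Complex-valued distributions on `ℝⁿ` are the elements of Mathlib's `𝓓'(⊤, ℂ)`, that is, the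
continuous linear maps from real test functions to `ℂ` (equivalently, the continuous complex-linear
functionals on complex test functions). All spaces below are sets of such distributions: a dual
space of a space containing the test functions as a dense subspace is identified with
the set of distributions that are restrictions of its elements. -/

/-- `K₁'(ℝⁿ)`: the distributions that are restrictions of continuous functionals on `K₁(ℝⁿ)`. -/
def K1Dual (n : ℕ) : Set 𝓓'((⊤ : Opens (Rn n)), ℂ) :=
  {f | ∃ F : K1 n →L[ℂ] ℂ, ∀ φ : 𝓓((⊤ : Opens (Rn n)), ℝ), F (K1.ofTest φ) = f φ}

/-- `B'_ω(ℝⁿ)`: the distributions that are restrictions of continuous functionals on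
`D_{L¹_ω}(ℝⁿ)`. -/
def BDual {n : ℕ} (ω : Weight n) : Set 𝓓'((⊤ : Opens (Rn n)), ℂ) :=
  {f | ∃ F : DL1 ω →L[ℂ] ℂ, ∀ φ : 𝓓((⊤ : Opens (Rn n)), ℝ), F (DL1.ofTest ω φ) = f φ}

/-- The image of `D(ℝⁿ)` in the dual of `D_{L¹_ω}(ℝⁿ)`: the functionals
`χ ↦ ∫ φ(t) χ(t) dt` with a complex-valued test function `φ`. -/
def testFunctionals {n : ℕ} (ω : Weight n) : Set (DL1 ω →L[ℂ] ℂ) :=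
  {F | ∃ φ : 𝓓((⊤ : Opens (Rn n)), ℂ), ∀ χ : DL1 ω, F χ = ∫ t, φ t * χ t}

/-- `Ḃ'_ω(ℝⁿ)`: the closure of `D(ℝⁿ)` in `B'_ω(ℝⁿ)` for the strong dual topology, which is the
standard topology (of uniform convergence on bounded sets) of `DL1 ω →L[ℂ] ℂ`. -/
def BDotDual {n : ℕ} (ω : Weight n) : Set 𝓓'((⊤ : Opens (Rn n)), ℂ) :=
  {f | ∃ F ∈ closure (testFunctionals ω),
    ∀ φ : 𝓓((⊤ : Opens (Rn n)), ℝ), F (DL1.ofTest ω φ) = f φ}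

/-! ### Translations -/

/-- The translation `T_h φ(t) = φ(t - h)` of test functions, as a continuous linear map. -/
noncomputable def translateTest {n : ℕ} (h : Rn n) :
    𝓓((⊤ : Opens (Rn n)), ℝ) →L[ℝ] 𝓓((⊤ : Opens (Rn n)), ℝ) :=
  TestFunction.limitCLM ℝ
    (fun φ => ⟨fun t => φ (t - h), φ.contDiff.comp (contDiff_id.sub contDiff_const),
      φ.hasCompactSupport.comp_homeomorph (Homeomorph.subRight h), Set.subset_univ _⟩)
    (fun K _ =>
      let K' : Compacts (Rn n) := ⟨(fun t => t + h) '' K, K.isCompact.image (by fun_prop)⟩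
      TestFunction.ofSupportedInCLM ℝ (K := K') (Set.subset_univ _) ∘L
        ContDiffMapSupportedIn.mkCLM ℝ (fun φ t => φ (t - h)) (fun _ _ _ => rfl)
          (fun _ _ _ => rfl) (fun φ => φ.contDiff.comp (contDiff_id.sub contDiff_const))
          (fun φ t ht => φ.zero_on_compl fun hK => ht ⟨t - h, hK, sub_add_cancel t h⟩)
          (fun i _ => ⟨{i}, 1, zero_le_one, fun φ t _ => by
            rw [iteratedFDeriv_comp_sub, Finset.sup_singleton, one_mul]
            exact ContDiffMapSupportedIn.norm_iteratedFDeriv_apply_le_seminorm_top ℝ⟩))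
    (fun _ _ _ => rfl)

@[simp]
theorem translateTest_apply {n : ℕ} (h : Rn n) (φ : 𝓓((⊤ : Opens (Rn n)), ℝ)) (t : Rn n) :
    translateTest h φ t = φ (t - h) := rfl

/-- The translation `T_h f = f(· - h)` of distributions: `⟨T_h f, φ⟩ = ⟨f, T_{-h} φ⟩`. -/
noncomputable def translate {n : ℕ} (h : Rn n) :
    𝓓'((⊤ : Opens (Rn n)), ℂ) →L[ℝ] 𝓓'((⊤ : Opens (Rn n)), ℂ) :=
  (translateTest (-h)).precompCompactConvergenceCLM ℂ

theorem translate_apply {n : ℕ} (h : Rn n) (f : 𝓓'((⊤ : Opens (Rn n)), ℂ))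
    (φ : 𝓓((⊤ : Opens (Rn n)), ℝ)) : translate h f φ = f (translateTest (-h) φ) := rfl

end ExpType

/-!
The three spaces meet in one estimate: `f` is bounded by a multiple of a norm `ν_k` of `K₁(ℝⁿ)`.

If the translates of `f`, damped by `exp (-s |h|)`, are bounded, they satisfy on test functions
supported in one fixed ball a common estimate by finitely many derivatives. Cutting a test function
by a partition of unity of lattice translates and summing the estimates of the pieces, which decay
exponentially along the lattice, bounds `f` by some `ν_k`.

Given such a bound, take `ω(t) = exp (k √(1 + |t|²))`. A Sobolev inequality on balls, where `ω` is
comparable to a constant, bounds `ν_k(φ)` by `L²` norms of finitely many `ω ∂^α φ`. By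
Hahn–Banach and Riesz, `f` is a finite sum of functionals `φ ↦ ∫ g_α ω ∂^α φ` with `g_α ∈ L²`.
Approximating `g_α` in `L²` by test functions and integrating by parts exhibits `f` as a limit of
test functions in `B'_ω(ℝⁿ)`.
-/

namespace ExpType

section Sobolev

variable {V : Type*} [NormedAddCommGroup V] [MeasurableSpace V] [BorelSpace V]

theorem integrable_exp_neg_norm [NormedSpace ℝ V] [FiniteDimensional ℝ V] (μ : Measure V)
    [μ.IsAddHaarMeasure] : Integrable (fun x : V => Real.exp (-‖x‖)) μ := by
  have bound (x : V) : ‖Real.exp (-‖x‖)‖ ≤ 1 := by simp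
  have decay (x : V) : ‖x‖ ^ (0 + μ.integrablePower) * ‖Real.exp (-‖x‖)‖
      ≤ μ.integrablePower.factorial := by
    have h := Real.pow_div_factorial_le_exp ‖x‖ (norm_nonneg x) μ.integrablePower
    rwa [zero_add, Real.norm_eq_abs, Real.abs_exp, Real.exp_neg, ← div_eq_mul_inv,
      div_le_iff₀' (Real.exp_pos _), ← div_le_iff₀ (by positivity)]
  have h := integrable_of_le_of_pow_mul_le (k := 0) bound decay (by fun_prop)
  simpa only [pow_zero, one_mul, Real.norm_eq_abs, Real.abs_exp] using h

variable [InnerProductSpace ℝ V] [FiniteDimensional ℝ V]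
  {E : Type*} [NormedAddCommGroup E] [NormedSpace ℂ E]

open FourierTransform in
theorem one_add_norm_pow_mul_norm_fourier_le {u : V → E} {d : ℕ} (hu : ContDiff ℝ d u)
    (hint : ∀ j ≤ d, Integrable (iteratedFDeriv ℝ j u)) (w : V) :
    (1 + ‖w‖) ^ d * ‖𝓕 u w‖ ≤
      4 ^ d * ∑ j ∈ Finset.range (d + 1), ∫ t, ‖iteratedFDeriv ℝ j u t‖ := by
  set S := ∑ j ∈ Finset.range (d + 1), ∫ t, ‖iteratedFDeriv ℝ j u t‖
  have decay (j : ℕ) (hj : j ≤ d) : ‖w‖ ^ j * ‖𝓕 u w‖ ≤ 2 ^ d * S := by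
    have h := Real.pow_mul_norm_iteratedFDeriv_fourier_le (f := u) (K := 0) (N := d)
      (mod_cast hu) (fun k i hk hi => by
        obtain rfl : k = 0 := by simpa using hk
        simpa using (hint i (mod_cast hi)).norm) (k := 0) (n := j) le_rfl (mod_cast hj) w
    simp only [norm_iteratedFDeriv_zero, pow_zero, one_mul, Nat.cast_zero, mul_zero, zero_add,
      Finset.range_one, Finset.sum_product, Finset.sum_singleton] at h
    refine h.trans (mul_le_mul (pow_le_pow_right₀ one_le_two hj) ?_
      (Finset.sum_nonneg fun _ _ => by positivity) (by positivity))
    exact Finset.sum_le_sum_of_subset_of_nonneg (Finset.range_mono (by omega))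
      fun _ _ _ => by positivity
  have hmax : (1 + ‖w‖) ^ d * ‖𝓕 u w‖ ≤ 2 ^ d * (2 ^ d * S) := by
    rcases le_total ‖w‖ 1 with hw | hw
    · calc (1 + ‖w‖) ^ d * ‖𝓕 u w‖ ≤ (1 + 1) ^ d * (‖w‖ ^ 0 * ‖𝓕 u w‖) := by
            rw [pow_zero, one_mul]; gcongr
        _ ≤ 2 ^ d * (2 ^ d * S) := by
            rw [one_add_one_eq_two]
            exact mul_le_mul_of_nonneg_left (decay 0 d.zero_le) (by positivity)
    · calc (1 + ‖w‖) ^ d * ‖𝓕 u w‖ ≤ (‖w‖ + ‖w‖) ^ d * ‖𝓕 u w‖ := by gcongr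
        _ = 2 ^ d * (‖w‖ ^ d * ‖𝓕 u w‖) := by rw [← two_mul, mul_pow, mul_assoc]
        _ ≤ 2 ^ d * (2 ^ d * S) := mul_le_mul_of_nonneg_left (decay d le_rfl) (by positivity)
  rwa [← mul_assoc, ← mul_pow, show (2 : ℝ) * 2 = 4 by norm_num] at hmax

open Module FourierTransform in
/-- Fourier inversion, with `d + 1` derivatives paid for the integrability of the transform. -/
theorem exists_norm_le_sum_integral_iteratedFDeriv (V E : Type*) [NormedAddCommGroup V]
    [InnerProductSpace ℝ V] [FiniteDimensional ℝ V] [MeasurableSpace V] [BorelSpace V]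
    [NormedAddCommGroup E] [NormedSpace ℂ E] [CompleteSpace E] :
    ∃ C : ℝ, 0 ≤ C ∧ ∀ u : V → E, ContDiff ℝ (finrank ℝ V + 1 : ℕ) u →
      (∀ j ≤ finrank ℝ V + 1, Integrable (iteratedFDeriv ℝ j u)) → ∀ x, ‖u x‖ ≤
        C * ∑ j ∈ Finset.range (finrank ℝ V + 2), ∫ t, ‖iteratedFDeriv ℝ j u t‖ := by
  have hpow := integrable_one_add_norm (E := V) (μ := volume) (r := (finrank ℝ V + 1 : ℕ))
    (mod_cast Nat.lt_succ_self _)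
  refine ⟨4 ^ (finrank ℝ V + 1) * ∫ w : V, (1 + ‖w‖) ^ (-((finrank ℝ V + 1 : ℕ) : ℝ)),
    by positivity, fun u hu hint x => ?_⟩
  set S := ∑ j ∈ Finset.range (finrank ℝ V + 2), ∫ t, ‖iteratedFDeriv ℝ j u t‖
  have decay (w : V) : ‖𝓕 u w‖ ≤
      4 ^ (finrank ℝ V + 1) * S * (1 + ‖w‖) ^ (-((finrank ℝ V + 1 : ℕ) : ℝ)) := by
    rw [Real.rpow_neg (by positivity), Real.rpow_natCast, ← div_eq_mul_inv,
      le_div_iff₀' (by positivity)]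
    exact one_add_norm_pow_mul_norm_fourier_le hu hint w
  have hui : Integrable u := by
    rw [← integrable_norm_iff hu.continuous.aestronglyMeasurable]
    exact (hint 0 (Nat.zero_le _)).norm.congr (ae_of_all _ fun _ => norm_iteratedFDeriv_zero)
  have hF : Continuous (𝓕 u) := VectorFourier.fourierIntegral_continuous
    Real.continuous_fourierChar (by simpa using continuous_inner) hui
  have hFi : Integrable (𝓕 u) :=
    (hpow.const_mul _).mono' hF.aestronglyMeasurable (ae_of_all _ decay)
  calc ‖u x‖ = ‖∫ w, Real.fourierChar (inner ℝ w x) • 𝓕 u w‖ := by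
        rw [← Real.fourierInv_eq, hui.fourierInv_fourier_eq hFi hu.continuous.continuousAt]
    _ ≤ ∫ w, ‖𝓕 u w‖ :=
        (norm_integral_le_integral_norm _).trans_eq (by simp only [Circle.norm_smul])
    _ ≤ ∫ w : V, 4 ^ (finrank ℝ V + 1) * S * (1 + ‖w‖) ^ (-((finrank ℝ V + 1 : ℕ) : ℝ)) :=
        integral_mono hFi.norm (hpow.const_mul _) decay
    _ = _ := by rw [integral_const_mul]; ring

end Sobolev

section Leibniz

variable {𝕜 E F : Type*} [NontriviallyNormedField 𝕜] [NormedAddCommGroup E] [NormedSpace 𝕜 E]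
  [NormedAddCommGroup F] [NormedSpace 𝕜 F]

theorem norm_iteratedFDeriv_iteratedFDeriv (f : E → F) (i j : ℕ) (x : E) :
    ‖iteratedFDeriv 𝕜 i (iteratedFDeriv 𝕜 j f) x‖ = ‖iteratedFDeriv 𝕜 (j + i) f x‖ := by
  induction j generalizing i with
  | zero =>
    rw [iteratedFDeriv_zero_eq_comp, LinearIsometryEquiv.norm_iteratedFDeriv_comp_left, zero_add]
  | succ j ih =>
    let e : (E →L[𝕜] (E [×j]→L[𝕜] F)) ≃ₗᵢ[𝕜] (E [×(j + 1)]→L[𝕜] F) :=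
      (continuousMultilinearCurryLeftEquiv 𝕜 (fun _ : Fin (j + 1) => E) F).symm
    have curry : iteratedFDeriv 𝕜 (j + 1) f = e ∘ fderiv 𝕜 (iteratedFDeriv 𝕜 j f) :=
      iteratedFDeriv_succ_eq_comp_left
    have isometry := LinearIsometryEquiv.norm_iteratedFDeriv_comp_left (𝕜 := 𝕜) (E := E)
      (F := E →L[𝕜] (E [×j]→L[𝕜] F)) (G := E [×(j + 1)]→L[𝕜] F) e
      (fderiv 𝕜 (iteratedFDeriv 𝕜 j f)) x i
    rw [curry, isometry, norm_iteratedFDeriv_fderiv, ih, add_right_comm, add_assoc]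

theorem norm_iteratedFDeriv_smul_le_of_bound {χ : E → 𝕜} {f : E → F} {j : ℕ} {B : ℝ} {x : E}
    (hχ : ContDiff 𝕜 j χ) (hf : ContDiff 𝕜 j f) (hB : ∀ i ≤ j, ‖iteratedFDeriv 𝕜 i χ x‖ ≤ B) :
    ‖iteratedFDeriv 𝕜 j (fun y => χ y • f y) x‖ ≤
      2 ^ j * B * ∑ i ∈ Finset.range (j + 1), ‖iteratedFDeriv 𝕜 i f x‖ := by
  set S := ∑ i ∈ Finset.range (j + 1), ‖iteratedFDeriv 𝕜 i f x‖
  have hB0 : 0 ≤ B := (norm_nonneg _).trans (hB 0 j.zero_le)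
  calc ‖iteratedFDeriv 𝕜 j (fun y => χ y • f y) x‖
      ≤ ∑ i ∈ Finset.range (j + 1), (j.choose i : ℝ) * ‖iteratedFDeriv 𝕜 i χ x‖
          * ‖iteratedFDeriv 𝕜 (j - i) f x‖ := norm_iteratedFDeriv_smul_le hχ hf x le_rfl
    _ ≤ ∑ i ∈ Finset.range (j + 1), (j.choose i : ℝ) * B * S := by
        gcongr with i hi
        · exact hB i (Finset.mem_range_succ_iff.1 hi)
        · exact Finset.single_le_sum (f := fun i => ‖iteratedFDeriv 𝕜 i f x‖)
            (fun _ _ => norm_nonneg _) (Finset.mem_range_succ_iff.2 (j.sub_le i))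
    _ = 2 ^ j * B * S := by
        rw [← Finset.sum_mul, ← Finset.sum_mul, ← Nat.cast_sum, Nat.sum_range_choose,
          Nat.cast_pow, Nat.cast_ofNat]

end Leibniz

section LocalSobolev

variable {V E : Type*} [NormedAddCommGroup V] [NormedSpace ℝ V] [NormedAddCommGroup E]
  [NormedSpace ℝ E]

theorem exists_norm_iteratedFDeriv_le {χ : V → E} {N : ℕ} (hχ : ContDiff ℝ N χ)
    (hs : HasCompactSupport χ) :
    ∃ B : ℝ, 0 ≤ B ∧ ∀ i ≤ N, ∀ x, ‖iteratedFDeriv ℝ i χ x‖ ≤ B := by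
  have hb (i : ℕ) : ∃ B : ℝ, i ≤ N → ∀ x, ‖iteratedFDeriv ℝ i χ x‖ ≤ B := by
    by_cases hi : i ≤ N
    · obtain ⟨B, hB⟩ := (hs.iteratedFDeriv (𝕜 := ℝ) i).exists_bound_of_continuous
        (hχ.continuous_iteratedFDeriv (mod_cast hi))
      exact ⟨B, fun _ => hB⟩
    · exact ⟨0, fun h => absurd h hi⟩
  choose B hB using hb
  refine ⟨∑ i ∈ Finset.range (N + 1), |B i|, by positivity, fun i hi x => ?_⟩
  exact (hB i hi x).trans <| (le_abs_self _).trans <|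
    Finset.single_le_sum (f := fun i => |B i|) (fun _ _ => abs_nonneg _)
      (Finset.mem_range_succ_iff.2 hi)

theorem sum_integral_iteratedFDeriv_smul_le [FiniteDimensional ℝ V] [MeasurableSpace V]
    [BorelSpace V] (μ : Measure V) [IsFiniteMeasureOnCompacts μ] {χ : V → ℝ} {u : V → E} {N : ℕ}
    {B r : ℝ} {x : V} (hχ : ContDiff ℝ N χ) (hu : ContDiff ℝ N u)
    (hB : ∀ i ≤ N, ∀ t, ‖iteratedFDeriv ℝ i χ t‖ ≤ B)
    (hsupp : tsupport χ ⊆ Metric.closedBall x r) :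
    ∑ j ∈ Finset.range (N + 1), ∫ t, ‖iteratedFDeriv ℝ j (fun t => χ t • u t) t‖ ∂μ ≤
      (N + 1) * (2 ^ N * B) *
        ∑ i ∈ Finset.range (N + 1), ∫ t in Metric.closedBall x r, ‖iteratedFDeriv ℝ i u t‖ ∂μ := by
  have hB0 : 0 ≤ B := (norm_nonneg _).trans (hB 0 N.zero_le x)
  have hcont (i : ℕ) (hi : i ∈ Finset.range (N + 1)) : IntegrableOn
      (fun t => ‖iteratedFDeriv ℝ i u t‖) (Metric.closedBall x r) μ :=
    ((hu.continuous_iteratedFDeriv (mod_cast Finset.mem_range_succ_iff.1 hi)).norm.continuousOn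
      ).integrableOn_compact (isCompact_closedBall x r)
  have pointwise (j : ℕ) (hj : j ≤ N) (t : V) :
      ‖iteratedFDeriv ℝ j (fun t => χ t • u t) t‖ ≤
        2 ^ N * B * ∑ i ∈ Finset.range (N + 1), ‖iteratedFDeriv ℝ i u t‖ :=
    (norm_iteratedFDeriv_smul_le_of_bound (hχ.of_le (mod_cast hj)) (hu.of_le (mod_cast hj))
      fun i hi => hB i (hi.trans hj) t).trans <| by
        gcongr
        norm_num
  have term (j : ℕ) (hj : j ∈ Finset.range (N + 1)) :
      ∫ t, ‖iteratedFDeriv ℝ j (fun t => χ t • u t) t‖ ∂μ ≤ 2 ^ N * B *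
        ∑ i ∈ Finset.range (N + 1), ∫ t in Metric.closedBall x r, ‖iteratedFDeriv ℝ i u t‖ ∂μ := by
    have hzero (t : V) (ht : t ∉ Metric.closedBall x r) :
        ‖iteratedFDeriv ℝ j (fun t => χ t • u t) t‖ = 0 := by
      rw [norm_eq_zero]
      exact image_eq_zero_of_notMem_tsupport fun h => ht <| hsupp <|
        tsupport_smul_subset_left χ u <| tsupport_iteratedFDeriv_subset j h
    rw [← setIntegral_eq_integral_of_forall_compl_eq_zero hzero, ← integral_finsetSum _ hcont,
      ← integral_const_mul]
    exact integral_mono_of_nonneg (ae_of_all _ fun _ => norm_nonneg _)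
      ((integrable_finsetSum _ hcont).const_mul _)
      (ae_of_all _ (pointwise j (Finset.mem_range_succ_iff.1 hj)))
  refine (Finset.sum_le_sum term).trans_eq ?_
  rw [Finset.sum_const, Finset.card_range, nsmul_eq_mul, ← mul_assoc, Nat.cast_succ]

end LocalSobolev

open Module in
theorem exists_norm_le_sum_setIntegral_iteratedFDeriv (V E : Type*) [NormedAddCommGroup V]
    [InnerProductSpace ℝ V] [FiniteDimensional ℝ V] [MeasurableSpace V] [BorelSpace V]
    [NormedAddCommGroup E] [NormedSpace ℂ E] [CompleteSpace E] :
    ∃ C : ℝ, 0 ≤ C ∧ ∀ u : V → E, ContDiff ℝ (finrank ℝ V + 1 : ℕ) u → ∀ x, ‖u x‖ ≤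
      C * ∑ j ∈ Finset.range (finrank ℝ V + 2),
        ∫ t in Metric.closedBall x 2, ‖iteratedFDeriv ℝ j u t‖ := by
  set N := finrank ℝ V + 1
  let χ : ContDiffBump (0 : V) := ⟨1, 2, one_pos, one_lt_two⟩
  obtain ⟨B, hB0, hB⟩ := exists_norm_iteratedFDeriv_le (N := N) χ.contDiff χ.hasCompactSupport
  obtain ⟨C, hC0, hC⟩ := exists_norm_le_sum_integral_iteratedFDeriv V E
  refine ⟨C * ((N + 1) * (2 ^ N * B)), by positivity, fun u hu x => ?_⟩
  let χx : V → ℝ := fun t => χ (t - x)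
  have hχx : ContDiff ℝ N χx := χ.contDiff.comp (contDiff_id.sub contDiff_const)
  have hBx (i : ℕ) (hi : i ≤ N) (t : V) : ‖iteratedFDeriv ℝ i χx t‖ ≤ B := by
    rw [iteratedFDeriv_comp_sub]; exact hB i hi _
  have hsupp : tsupport χx ⊆ Metric.closedBall x 2 := by
    refine closure_minimal (fun t ht => ?_) Metric.isClosed_closedBall
    have : t - x ∈ Function.support χ := ht
    rw [χ.support_eq] at this
    simpa [χ, dist_eq_norm] using (mem_ball_zero_iff.1 this).le
  have hcs : HasCompactSupport fun t => χx t • u t :=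
    (HasCompactSupport.of_support_subset_isCompact (isCompact_closedBall x 2)
      ((subset_tsupport _).trans hsupp)).smul_right
  have hsmooth : ContDiff ℝ N fun t => χx t • u t := hχx.smul hu
  calc ‖u x‖ = ‖χx x • u x‖ := by
        have : χx x = 1 := by
          simp only [χx, sub_self]
          exact χ.one_of_mem_closedBall (by simp [χ])
        rw [this, one_smul]
    _ ≤ C * ∑ j ∈ Finset.range (N + 1), ∫ t, ‖iteratedFDeriv ℝ j (fun t => χx t • u t) t‖ :=
        hC _ hsmooth (fun j hj => (hsmooth.continuous_iteratedFDeriv (mod_cast hj)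
          ).integrable_of_hasCompactSupport (hcs.iteratedFDeriv (𝕜 := ℝ) j)) x
    _ ≤ C * ((N + 1) * (2 ^ N * B) * _) := by
        gcongr
        exact sum_integral_iteratedFDeriv_smul_le volume hχx hu hBx hsupp
    _ = _ := by rw [← mul_assoc]

section Seminorms

theorem withSeminorms_restrictScalars {𝕜 𝕜' E ι : Type*} [NormedField 𝕜] [NormedField 𝕜']
    [NormedAlgebra 𝕜 𝕜'] [AddCommGroup E] [Module 𝕜 E] [Module 𝕜' E] [IsScalarTower 𝕜 𝕜' E]
    [TopologicalSpace E] {p : SeminormFamily 𝕜' E ι} (hp : WithSeminorms p) :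
    WithSeminorms fun i => (p i).restrictScalars 𝕜 := by
  have := hp.topologicalAddGroup
  rw [SeminormFamily.withSeminorms_iff_topologicalSpace_eq_iInf] at hp ⊢
  exact hp

theorem exists_norm_apply_le_of_monotone {𝕜 E F : Type*} [NontriviallyNormedField 𝕜]
    [AddCommGroup E] [Module 𝕜 E] [TopologicalSpace E] [SeminormedAddCommGroup F] [NormedSpace 𝕜 F]
    {p : SeminormFamily 𝕜 E ℕ} (hp : WithSeminorms p) (hmono : Monotone p) (L : E →L[𝕜] F) :
    ∃ (k : ℕ) (C : ℝ), 0 ≤ C ∧ ∀ x, ‖L x‖ ≤ C * p k x := by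
  obtain ⟨s, C, -, h⟩ := Seminorm.bound_of_continuous hp
    ((normSeminorm 𝕜 F).comp L.toLinearMap) (continuous_norm.comp L.continuous)
  have hsup : s.sup p ≤ p (s.sup id) :=
    Finset.sup_le fun i hi => hmono (Finset.le_sup (f := id) hi)
  refine ⟨s.sup id, C, C.2, fun x => (h x).trans ?_⟩
  exact mul_le_mul_of_nonneg_left (hsup x) C.2

/-- A violating sequence `x m` could be rescaled to a null sequence on which the maps are
unbounded. -/
theorem exists_forall_norm_apply_le_of_isCompact {ι E F : Type*} [AddCommGroup E] [Module ℝ E]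
    [TopologicalSpace E] [SeminormedAddCommGroup F] [NormedSpace ℝ F] {p : SeminormFamily ℝ E ℕ}
    (hp : WithSeminorms p) (hmono : Monotone p) {u : ι → E →ₗ[ℝ] F}
    (hu : ∀ K : Set E, IsCompact K → ∃ R, ∀ i, ∀ x ∈ K, ‖u i x‖ ≤ R) :
    ∃ (k : ℕ) (C : ℝ), 0 ≤ C ∧ ∀ i x, ‖u i x‖ ≤ C * p k x := by
  by_contra! H
  choose i x hlt using fun m : ℕ => H m (((m : ℝ) + 1) ^ 2) (by positivity)
  have hpos (m : ℕ) : 0 < ‖u (i m) (x m)‖ := lt_of_le_of_lt (by positivity) (hlt m)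
  let y (m : ℕ) : E := (((m : ℝ) + 1) / ‖u (i m) (x m)‖) • x m
  have hpy (m : ℕ) : p m (y m) ≤ 1 / ((m : ℝ) + 1) := by
    rw [map_smul_eq_mul, Real.norm_of_nonneg (by positivity), div_mul_eq_mul_div,
      div_le_div_iff₀ (hpos m) (by positivity)]
    linarith [hlt m]
  have huy (m : ℕ) : ‖u (i m) (y m)‖ = m + 1 := by
    rw [map_smul, norm_smul, Real.norm_of_nonneg (by positivity), div_mul_cancel₀ _ (hpos m).ne']
  have hy : Filter.Tendsto y Filter.atTop (nhds 0) := by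
    rw [hp.tendsto_nhds_atTop]
    intro k ε hε
    obtain ⟨m₀, hm₀⟩ := exists_nat_one_div_lt hε
    refine ⟨max k m₀, fun m hm => ?_⟩
    calc p k (y m - 0) ≤ p m (y m) := by
          rw [sub_zero]; exact hmono ((le_max_left _ _).trans hm) _
      _ ≤ 1 / ((m : ℝ) + 1) := hpy m
      _ ≤ 1 / ((m₀ : ℝ) + 1) := by gcongr; exact (le_max_right _ _).trans hm
      _ < ε := hm₀
  obtain ⟨R, hR⟩ := hu _ hy.isCompact_insert_range
  obtain ⟨m, hm⟩ := exists_nat_gt R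
  have := hR (i m) (y m) (Set.mem_insert_of_mem _ (Set.mem_range_self m))
  linarith [huy m]

end Seminorms

section ExponentialOrder

variable {n : ℕ}

theorem norm_iteratedFDeriv_ofReal {E : Type*} [NormedAddCommGroup E] [NormedSpace ℝ E] {φ : E → ℝ}
    {j : ℕ} (hφ : ContDiff ℝ j φ) (t : E) :
    ‖iteratedFDeriv ℝ j (fun t => (φ t : ℂ)) t‖ = ‖iteratedFDeriv ℝ j φ t‖ :=
  Complex.ofRealLI.norm_iteratedFDeriv_comp_left hφ.contDiffAt (i := j) le_rfl

namespace K1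

theorem exp_mul_norm_le_nu {k j : ℕ} (hj : j ≤ k) (φ : K1 n) (t : Rn n) :
    Real.exp (k * ‖t‖) * ‖iteratedFDeriv ℝ j φ t‖ ≤ nu n k φ := by
  have bdd : BddAbove
      (Set.range fun t : Rn n => Real.exp (k * ‖t‖) * ‖iteratedFDeriv ℝ j φ t‖) := by
    obtain ⟨C, hC⟩ := φ.2.2 k j
    exact ⟨C, Set.forall_mem_range.2 hC⟩
  calc Real.exp (k * ‖t‖) * ‖iteratedFDeriv ℝ j φ t‖ ≤ weightedSup n k j φ := le_ciSup bdd t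
    _ ≤ nu n k φ := Seminorm.le_finset_sup_apply (p := fun j => weightedSup n k j)
        (Finset.mem_range_succ_iff.2 hj)

theorem norm_iteratedFDeriv_le_nu {k j : ℕ} (hj : j ≤ k) (φ : K1 n) (t : Rn n) :
    ‖iteratedFDeriv ℝ j φ t‖ ≤ nu n k φ * Real.exp (-(k * ‖t‖)) := by
  rw [Real.exp_neg, ← div_eq_mul_inv, le_div_iff₀' (Real.exp_pos _)]
  exact exp_mul_norm_le_nu hj φ t

theorem norm_iteratedFDeriv_add_le_nu {k j : ℕ} (hj : j ≤ k) (φ : K1 n) {t : Rn n} {r : ℝ}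
    (ht : ‖t‖ ≤ r) (h : Rn n) : ‖iteratedFDeriv ℝ j φ (t + h)‖ ≤
      Real.exp (k * r) * (nu n k φ * Real.exp (-(k * ‖h‖))) := by
  have hnorm : (k : ℝ) * ‖h‖ ≤ k * ‖t + h‖ + k * r := by
    rw [← mul_add]
    gcongr
    have := norm_sub_le (t + h) t
    rw [add_sub_cancel_left] at this
    linarith
  refine (norm_iteratedFDeriv_le_nu hj φ (t + h)).trans ?_
  rw [mul_left_comm, ← Real.exp_add]
  gcongr
  linarith

theorem nu_le {k : ℕ} {φ : K1 n} {R : ℝ} (hR : 0 ≤ R)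
    (h : ∀ j ≤ k, ∀ t, Real.exp (k * ‖t‖) * ‖iteratedFDeriv ℝ j φ t‖ ≤ R) : nu n k φ ≤ R :=
  Seminorm.finset_sup_apply_le hR fun j hj =>
    Real.iSup_le (h j (Finset.mem_range_succ_iff.1 hj)) hR

theorem nu_mono (n : ℕ) : Monotone (nu n) := by
  intro k l hkl φ
  refine nu_le (apply_nonneg _ _) fun j hj t => le_trans ?_ (exp_mul_norm_le_nu (hj.trans hkl) φ t)
  gcongr

/-- `K1.ofTest` as a real-linear map. -/
noncomputable def ofTestₗ (n : ℕ) : 𝓓((⊤ : Opens (Rn n)), ℝ) →ₗ[ℝ] K1 n where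
  toFun := ofTest
  map_add' _ _ := Subtype.ext (funext fun _ => Complex.ofReal_add _ _)
  map_smul' _ _ := Subtype.ext (funext fun _ => Complex.ofReal_mul _ _)

theorem norm_iteratedFDeriv_ofTest (φ : 𝓓((⊤ : Opens (Rn n)), ℝ)) (j : ℕ) (t : Rn n) :
    ‖iteratedFDeriv ℝ j (ofTest φ) t‖ = ‖iteratedFDeriv ℝ j φ t‖ :=
  norm_iteratedFDeriv_ofReal (φ.contDiff.of_le (mod_cast le_top)) t

theorem nu_ofTest_ofSupportedIn_le {K : Compacts (Rn n)}
    (hK : (K : Set (Rn n)) ⊆ (⊤ : Opens (Rn n))) {R : ℝ} (hR : ∀ t ∈ K, ‖t‖ ≤ R) (k : ℕ)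
    (ψ : 𝓓_{K}(Rn n, ℝ)) :
    nu n k (ofTest (TestFunction.ofSupportedIn hK ψ)) ≤ Real.exp (k * R) *
      (Finset.range (k + 1)).sup (ContDiffMapSupportedIn.seminorm ℝ (Rn n) ℝ ⊤ K) ψ := by
  refine nu_le (by positivity) fun j hj t => ?_
  rw [norm_iteratedFDeriv_ofTest]
  change _ * ‖iteratedFDeriv ℝ j ψ t‖ ≤ _
  by_cases ht : t ∈ K
  · gcongr
    · exact hR t ht
    · exact (ContDiffMapSupportedIn.norm_iteratedFDeriv_apply_le_seminorm_top ℝ).trans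
        (Seminorm.le_finset_sup_apply (Finset.mem_range_succ_iff.2 hj))
  · rw [ψ.iteratedFDeriv_zero_on_compl ht, Pi.zero_apply, norm_zero, mul_zero]
    positivity

theorem continuous_ofTest (n : ℕ) : Continuous (ofTest : 𝓓((⊤ : Opens (Rn n)), ℝ) → K1 n) := by
  have := (withSeminorms n).topologicalAddGroup
  have := (withSeminorms n).continuousSMul
  have := (withSeminorms n).toLocallyConvexSpace
  have : ContinuousSMul ℝ (K1 n) := IsScalarTower.continuousSMul ℂ
  change Continuous (ofTestₗ n)
  rw [TestFunction.continuous_iff_continuous_comp]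
  intro K hK
  obtain ⟨R, hR⟩ := K.isCompact.isBounded.exists_norm_le
  exact (ContDiffMapSupportedIn.withSeminorms ℝ (Rn n) ℝ ⊤ K).continuous_of_isBounded
    (withSeminorms_restrictScalars (𝕜 := ℝ) (withSeminorms n))
    (ofTestₗ n ∘ₗ (TestFunction.ofSupportedInCLM ℝ hK).toLinearMap)
    fun k => ⟨Finset.range (k + 1), ⟨Real.exp (k * R), by positivity⟩,
      nu_ofTest_ofSupportedIn_le hK hR k⟩

theorem nu_ofTest_translateTest_le (k : ℕ) (h : Rn n) (φ : 𝓓((⊤ : Opens (Rn n)), ℝ)) :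
    nu n k (ofTest (translateTest h φ)) ≤ Real.exp (k * ‖h‖) * nu n k (ofTest φ) := by
  refine nu_le (by positivity) fun j hj t => ?_
  have hshift : iteratedFDeriv ℝ j (ofTest (translateTest h φ)) t
      = iteratedFDeriv ℝ j (ofTest φ) (t - h) :=
    iteratedFDeriv_comp_sub (f := fun t => (φ t : ℂ)) j h t
  have hnorm : (k : ℝ) * ‖t‖ ≤ k * ‖h‖ + k * ‖t - h‖ := by
    rw [← mul_add]
    gcongr
    exact norm_le_norm_add_norm_sub' t h
  calc Real.exp (k * ‖t‖) * ‖iteratedFDeriv ℝ j (ofTest (translateTest h φ)) t‖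
      ≤ Real.exp (k * ‖h‖ + k * ‖t - h‖) * ‖iteratedFDeriv ℝ j (ofTest φ) (t - h)‖ := by
        rw [hshift]; gcongr
    _ = Real.exp (k * ‖h‖) *
          (Real.exp (k * ‖t - h‖) * ‖iteratedFDeriv ℝ j (ofTest φ) (t - h)‖) := by
        rw [Real.exp_add, mul_assoc]
    _ ≤ Real.exp (k * ‖h‖) * nu n k (ofTest φ) := by
        gcongr; exact exp_mul_norm_le_nu hj (ofTest φ) (t - h)

end K1

/-- A distribution has exponential order `k` if it is bounded by a multiple of the norm `ν_k` of
`K₁(ℝⁿ)`. This is the quantitative form of belonging to `K₁'(ℝⁿ)` through which all the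
inclusions pass. -/
def HasExpOrder (f : 𝓓'((⊤ : Opens (Rn n)), ℂ)) (k : ℕ) : Prop :=
  ∃ C : ℝ, 0 ≤ C ∧ ∀ φ : 𝓓((⊤ : Opens (Rn n)), ℝ), ‖f φ‖ ≤ C * K1.nu n k (K1.ofTest φ)

theorem exists_hasExpOrder_of_mem_K1Dual {f : 𝓓'((⊤ : Opens (Rn n)), ℂ)} (hf : f ∈ K1Dual n) :
    ∃ k, HasExpOrder f k := by
  obtain ⟨F, hF⟩ := hf
  obtain ⟨k, C, hC, h⟩ := exists_norm_apply_le_of_monotone (K1.withSeminorms n) (K1.nu_mono n) F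
  exact ⟨k, C, hC, fun φ => hF φ ▸ h (K1.ofTest φ)⟩

theorem HasExpOrder.isVonNBounded_translates {f : 𝓓'((⊤ : Opens (Rn n)), ℂ)} {k : ℕ}
    (hf : HasExpOrder f k) : IsVonNBounded ℝ
      (Set.range fun h : Rn n => Real.exp (-k * ‖h‖) • translate (-h) f) := by
  obtain ⟨C, hC, hfC⟩ := hf
  refine UniformConvergenceCLM.isVonNBounded_iff.2 fun S hS => ?_
  obtain ⟨R, hR⟩ := (hS.image (((K1.withSeminorms n).continuous_seminorm k).comp
    (K1.continuous_ofTest n))).bddAbove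
  rw [NormedSpace.isVonNBounded_iff, isBounded_iff_forall_norm_le]
  refine ⟨C * R, ?_⟩
  rintro _ ⟨_, ⟨h, rfl⟩, φ, hφ, rfl⟩
  calc ‖Real.exp (-k * ‖h‖) • translate (-h) f φ‖
      = Real.exp (-k * ‖h‖) * ‖f (translateTest h φ)‖ := by
        rw [translate_apply, neg_neg, norm_smul, Real.norm_of_nonneg (Real.exp_pos _).le]
    _ ≤ Real.exp (-k * ‖h‖) * (C * (Real.exp (k * ‖h‖) * K1.nu n k (K1.ofTest φ))) := by
        gcongr
        exact (hfC _).trans (mul_le_mul_of_nonneg_left (K1.nu_ofTest_translateTest_le k h φ) hC)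
    _ = C * K1.nu n k (K1.ofTest φ) := by
        rw [neg_mul, Real.exp_neg]
        field_simp
    _ ≤ C * R := by
        gcongr
        exact hR (Set.mem_image_of_mem _ hφ)

end ExponentialOrder

section Lattice

variable {n : ℕ}

theorem sum_Ico_int_sub (g : ℤ → ℝ) {a b : ℤ} (hab : a ≤ b) :
    ∑ k ∈ Finset.Ico a b, (g k - g (k + 1)) = g a - g b := by
  induction b, hab using Int.leInduction with
  | base => simp
  | succ b hab ih =>
    rw [← Finset.insert_Ico_right_eq_Ico_add_one hab, Finset.sum_insert Finset.right_notMem_Ico, ih]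
    ring

/-- A smooth function supported in `[-1, 1]ⁿ` whose translates by `ℤⁿ` form a partition of unity:
in each coordinate the sum over the translates telescopes. -/
noncomputable def cellFun (n : ℕ) (x : Rn n) : ℝ :=
  ∏ i, (Real.smoothTransition (x i + 1) - Real.smoothTransition (x i))

theorem contDiff_cellFun (n : ℕ) : ContDiff ℝ (⊤ : ℕ∞) (cellFun n) := by
  refine contDiff_prod fun i _ => ?_
  have hcoord : ContDiff ℝ (⊤ : ℕ∞) fun x : Rn n => x i := contDiff_piLp_apply (p := 2)
  exact (Real.smoothTransition.contDiff.comp (hcoord.add contDiff_const)).sub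
    (Real.smoothTransition.contDiff.comp hcoord)

theorem support_cellFun (n : ℕ) : Function.support (cellFun n) ⊆ Metric.closedBall 0 n := by
  intro x hx
  have hcoord (i : Fin n) : |x i| ≤ 1 := by
    by_contra! h
    refine hx (Finset.prod_eq_zero (Finset.mem_univ i) ?_)
    rcases lt_abs.1 h with h | h
    · rw [Real.smoothTransition.one_of_one_le (by linarith),
        Real.smoothTransition.one_of_one_le h.le, sub_self]
    · rw [Real.smoothTransition.zero_of_nonpos (by linarith),
        Real.smoothTransition.zero_of_nonpos (by linarith), sub_self]
  rw [mem_closedBall_zero_iff, EuclideanSpace.norm_eq, Real.sqrt_le_left (by positivity)]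
  calc ∑ i, ‖x i‖ ^ 2 ≤ ∑ _i : Fin n, (1 : ℝ) := by
        gcongr with i
        exact pow_le_one₀ (norm_nonneg _) (hcoord i)
    _ = n := by simp
    _ ≤ (n : ℝ) ^ 2 := by exact_mod_cast Nat.le_self_pow two_ne_zero n

theorem hasCompactSupport_cellFun (n : ℕ) : HasCompactSupport (cellFun n) :=
  HasCompactSupport.of_support_subset_isCompact (isCompact_closedBall 0 _) (support_cellFun n)

/-- The point of the lattice `ℤⁿ ⊆ ℝⁿ` with the given coordinates. -/
noncomputable def latticePt (m : Fin n → ℤ) : Rn n := WithLp.toLp 2 fun i => (m i : ℝ)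

theorem sum_cellFun_sub_latticePt {M : ℕ} {x : Rn n} (hx : ‖x‖ ≤ M) :
    ∑ m ∈ Fintype.piFinset fun _ : Fin n => Finset.Ico (-M : ℤ) (M + 1),
      cellFun n (x - latticePt m) = 1 := by
  let g (i : Fin n) (k : ℤ) : ℝ := Real.smoothTransition (x i - k + 1)
  have hg (i : Fin n) : ∑ k ∈ Finset.Ico (-M : ℤ) (M + 1), (g i k - g i (k + 1)) = 1 := by
    have hxi : |x i| ≤ M := (PiLp.norm_apply_le x i).trans hx
    have h_left : g i (-M) = 1 := Real.smoothTransition.one_of_one_le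
      (by push_cast; linarith [neg_le_of_abs_le hxi])
    have h_right : g i (M + 1) = 0 := Real.smoothTransition.zero_of_nonpos
      (by push_cast; linarith [le_of_abs_le hxi])
    rw [sum_Ico_int_sub _ (by lia), h_left, h_right, sub_zero]
  have hcell (m : Fin n → ℤ) :
      cellFun n (x - latticePt m) = ∏ i, (g i (m i) - g i (m i + 1)) := by
    refine Finset.prod_congr rfl fun i _ => ?_
    simp only [g, latticePt, PiLp.sub_apply]
    push_cast
    congr 2
    ring
  simp only [hcell]
  rw [← Finset.prod_univ_sum (fun _ => Finset.Ico (-M : ℤ) (M + 1))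
    (fun i k => g i k - g i (k + 1))]
  exact Finset.prod_eq_one fun i _ => hg i

theorem sum_exp_neg_norm_latticePt_le (n : ℕ) (s : Finset ℤ) :
    ∑ m ∈ Fintype.piFinset fun _ : Fin n => s, Real.exp (-(n * ‖latticePt m‖)) ≤
      (∑' k : ℤ, Real.exp (-|(k : ℝ)|)) ^ n := by
  have hsummable : Summable fun k : ℤ => Real.exp (-|(k : ℝ)|) := by
    refine Summable.of_nat_of_neg ?_ ?_ <;> simpa using Real.summable_exp_neg_nat
  have hnorm (m : Fin n → ℤ) : ∑ i, |(m i : ℝ)| ≤ n * ‖latticePt m‖ :=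
    calc ∑ i, |(m i : ℝ)| ≤ ∑ _i : Fin n, ‖latticePt m‖ :=
          Finset.sum_le_sum fun i _ => PiLp.norm_apply_le (latticePt m) i
      _ = n * ‖latticePt m‖ := by simp
  calc ∑ m ∈ Fintype.piFinset fun _ : Fin n => s, Real.exp (-(n * ‖latticePt m‖))
      ≤ ∑ m ∈ Fintype.piFinset fun _ : Fin n => s, ∏ i, Real.exp (-|(m i : ℝ)|) := by
        gcongr with m
        rw [← Real.exp_sum, Finset.sum_neg_distrib]
        gcongr
        exact hnorm m
    _ = ∏ _i : Fin n, ∑ k ∈ s, Real.exp (-|(k : ℝ)|) :=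
        (Finset.prod_univ_sum _ fun _ (k : ℤ) => Real.exp (-|(k : ℝ)|)).symm
    _ = (∑ k ∈ s, Real.exp (-|(k : ℝ)|)) ^ n := by simp
    _ ≤ (∑' k : ℤ, Real.exp (-|(k : ℝ)|)) ^ n := by
        gcongr
        exact hsummable.sum_le_tsum _ fun _ _ => (Real.exp_pos _).le

/-- A closed ball containing the support of `cellFun`. -/
def cell (n : ℕ) : Compacts (Rn n) := ⟨Metric.closedBall 0 n, isCompact_closedBall 0 _⟩

/-- The part of `φ` near the lattice point `m`, moved to the origin so that all pieces are supported
in the same compact set. -/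
noncomputable def cellPiece (φ : 𝓓((⊤ : Opens (Rn n)), ℝ)) (m : Fin n → ℤ) :
    𝓓_{cell n}(Rn n, ℝ) :=
  ContDiffMapSupportedIn.of_support_subset (f := fun t => cellFun n t • φ (t + latticePt m))
    ((contDiff_cellFun n).smul (φ.contDiff.comp (contDiff_id.add contDiff_const)))
    ((Function.support_smul_subset_left _ _).trans (support_cellFun n))

theorem translateTest_cellPiece_apply (φ : 𝓓((⊤ : Opens (Rn n)), ℝ)) (m : Fin n → ℤ) (x : Rn n) :
    translateTest (latticePt m)
      (TestFunction.ofSupportedIn (Ω := ⊤) (Set.subset_univ _) (cellPiece φ m)) x =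
      cellFun n (x - latticePt m) * φ x := by
  change cellFun n (x - latticePt m) * φ (x - latticePt m + latticePt m) = _
  rw [sub_add_cancel]

theorem exists_sum_translateTest_cellPiece (φ : 𝓓((⊤ : Opens (Rn n)), ℝ)) :
    ∃ s : Finset ℤ, ∑ m ∈ Fintype.piFinset fun _ : Fin n => s, translateTest (latticePt m)
      (TestFunction.ofSupportedIn (Set.subset_univ _) (cellPiece φ m)) = φ := by
  obtain ⟨R, hR⟩ := φ.hasCompactSupport.isBounded.exists_norm_le
  obtain ⟨M, hM⟩ := exists_nat_ge R
  refine ⟨Finset.Ico (-M : ℤ) (M + 1), ?_⟩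
  ext x
  let evalAt : 𝓓((⊤ : Opens (Rn n)), ℝ) →+ ℝ :=
    { toFun := fun ψ => ψ x, map_zero' := rfl, map_add' := fun _ _ => rfl }
  refine (map_sum evalAt _ _).trans ?_
  refine (Finset.sum_congr rfl fun m _ => translateTest_cellPiece_apply φ m x).trans ?_
  rw [← Finset.sum_mul]
  by_cases hx : φ x = 0
  · rw [hx, mul_zero]
  · rw [sum_cellFun_sub_latticePt ((hR x (subset_tsupport _ hx)).trans hM), one_mul]

theorem exists_norm_iteratedFDeriv_cellPiece_le {N k : ℕ} (hNk : N ≤ k) :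
    ∃ C : ℝ, 0 ≤ C ∧ ∀ (φ : 𝓓((⊤ : Opens (Rn n)), ℝ)) (m : Fin n → ℤ), ∀ j ≤ N, ∀ t,
      ‖iteratedFDeriv ℝ j (cellPiece φ m) t‖ ≤
        C * (K1.nu n k (K1.ofTest φ) * Real.exp (-(k * ‖latticePt m‖))) := by
  obtain ⟨B, hB, hcell⟩ := exists_norm_iteratedFDeriv_le
    ((contDiff_cellFun n).of_le (by exact_mod_cast le_top) : ContDiff ℝ N (cellFun n))
    (hasCompactSupport_cellFun n)
  refine ⟨2 ^ N * B * ((N + 1) * Real.exp (k * n)), by positivity, fun φ m j hj t => ?_⟩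
  by_cases ht : t ∈ cell n
  swap
  · rw [(cellPiece φ m).iteratedFDeriv_zero_on_compl ht, Pi.zero_apply, norm_zero]
    positivity
  have hφ : ∀ i ∈ Finset.range (j + 1), ‖iteratedFDeriv ℝ i (fun t => φ (t + latticePt m)) t‖ ≤
      Real.exp (k * n) * (K1.nu n k (K1.ofTest φ) * Real.exp (-(k * ‖latticePt m‖))) := by
    intro i hi
    rw [iteratedFDeriv_comp_add_right, ← K1.norm_iteratedFDeriv_ofTest]
    exact K1.norm_iteratedFDeriv_add_le_nu ((Finset.mem_range_succ_iff.1 hi).trans (hj.trans hNk))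
      (K1.ofTest φ) (mem_closedBall_zero_iff.1 ht) _
  calc ‖iteratedFDeriv ℝ j (cellPiece φ m) t‖
      ≤ 2 ^ j * B * ∑ i ∈ Finset.range (j + 1),
          ‖iteratedFDeriv ℝ i (fun t => φ (t + latticePt m)) t‖ :=
        norm_iteratedFDeriv_smul_le_of_bound
          ((contDiff_cellFun n).of_le (by exact_mod_cast le_top))
          ((φ.contDiff.comp (contDiff_id.add contDiff_const)).of_le (by exact_mod_cast le_top))
          fun i hi => hcell i (hi.trans hj) t
    _ ≤ 2 ^ N * B * ((N + 1) * (Real.exp (k * n) *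
          (K1.nu n k (K1.ofTest φ) * Real.exp (-(k * ‖latticePt m‖))))) := by
        gcongr
        · exact one_le_two
        · refine (Finset.sum_le_card_nsmul _ _ _ hφ).trans ?_
          rw [Finset.card_range, nsmul_eq_mul]
          push_cast
          gcongr
    _ = _ := by ring

theorem exists_norm_apply_translateTest_le {f : 𝓓'((⊤ : Opens (Rn n)), ℂ)} {s : ℝ}
    (hf : IsVonNBounded ℝ (Set.range fun h : Rn n => Real.exp (-s * ‖h‖) • translate (-h) f))
    (K : Compacts (Rn n)) :
    ∃ (N : ℕ) (C : ℝ), 0 ≤ C ∧ ∀ (h : Rn n) (ψ : 𝓓_{K}(Rn n, ℝ)) (P : ℝ),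
      (∀ j ≤ N, ∀ t, ‖iteratedFDeriv ℝ j ψ t‖ ≤ P) →
      ‖f (translateTest h (TestFunction.ofSupportedIn (Set.subset_univ _) ψ))‖
        ≤ C * Real.exp (s * ‖h‖) * P := by
  let ι : 𝓓_{K}(Rn n, ℝ) →L[ℝ] 𝓓((⊤ : Opens (Rn n)), ℝ) :=
    TestFunction.ofSupportedInCLM ℝ (Set.subset_univ _)
  let u (h : Rn n) : 𝓓_{K}(Rn n, ℝ) →ₗ[ℝ] ℂ :=
    Real.exp (-s * ‖h‖) • (f.toLinearMap ∘ₗ (translateTest h).toLinearMap ∘ₗ ι.toLinearMap)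
  obtain ⟨N, C, hC, hu⟩ := exists_forall_norm_apply_le_of_isCompact (u := u)
    (ContDiffMapSupportedIn.withSeminorms ℝ (Rn n) ℝ ⊤ K).partial_sups
    (fun i j hij => Finset.sup_mono (Finset.Iic_subset_Iic.2 hij)) fun S hS => by
      obtain ⟨R, hR⟩ := ((NormedSpace.isVonNBounded_iff ℝ).1
        (UniformConvergenceCLM.isVonNBounded_iff.1 hf _ (hS.image ι.continuous))).exists_norm_le
      refine ⟨R, fun h ψ hψ => ?_⟩
      have := hR _ (Set.mem_image2_of_mem (Set.mem_range_self h) (Set.mem_image_of_mem _ hψ))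
      change ‖Real.exp (-s * ‖h‖) • translate (-h) f (ι ψ)‖ ≤ R at this
      rwa [translate_apply, neg_neg] at this
  refine ⟨N, C, hC, fun h ψ P hP => ?_⟩
  have hP0 : 0 ≤ P := (norm_nonneg _).trans (hP 0 N.zero_le 0)
  have hψ : ((Finset.Iic N).sup (ContDiffMapSupportedIn.seminorm ℝ (Rn n) ℝ ⊤ K)) ψ ≤ P :=
    Seminorm.finset_sup_apply_le hP0 fun j hj =>
      (ContDiffMapSupportedIn.seminorm_top_le_iff ℝ hP0 j ψ).2 fun t _ =>
        hP j (Finset.mem_Iic.1 hj) t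
  have hf_le : Real.exp (-s * ‖h‖) * ‖f (translateTest h (ι ψ))‖ ≤ C * P := by
    have := (hu h ψ).trans (mul_le_mul_of_nonneg_left hψ hC)
    rwa [LinearMap.smul_apply, norm_smul, Real.norm_of_nonneg (Real.exp_pos _).le] at this
  rw [neg_mul, Real.exp_neg, inv_mul_le_iff₀ (Real.exp_pos _)] at hf_le
  exact hf_le.trans_eq (by ring)

theorem exists_hasExpOrder_of_isVonNBounded {f : 𝓓'((⊤ : Opens (Rn n)), ℂ)} {s : ℝ}
    (hf : IsVonNBounded ℝ (Set.range fun h : Rn n => Real.exp (-s * ‖h‖) • translate (-h) f)) :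
    ∃ k, HasExpOrder f k := by
  obtain ⟨N, C, hC, hfC⟩ := exists_norm_apply_translateTest_le hf (cell n)
  obtain ⟨l, hl⟩ := exists_nat_ge (s + n)
  set k := max N l
  have hsk : s + n ≤ k := hl.trans (by exact_mod_cast le_max_right N l)
  obtain ⟨D, hD, hpiece⟩ := exists_norm_iteratedFDeriv_cellPiece_le (n := n) (le_max_left N l)
  set Z : ℝ := (∑' j : ℤ, Real.exp (-|(j : ℝ)|)) ^ n
  have : 0 ≤ Z := pow_nonneg (tsum_nonneg fun _ => (Real.exp_pos _).le) _
  refine ⟨k, C * D * Z, by positivity, fun φ => ?_⟩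
  set ν := K1.nu n k (K1.ofTest φ)
  have : 0 ≤ ν := apply_nonneg _ _
  obtain ⟨S, hS⟩ := exists_sum_translateTest_cellPiece φ
  have hterm (m : Fin n → ℤ) : ‖f (translateTest (latticePt m)
      (TestFunction.ofSupportedIn (Set.subset_univ _) (cellPiece φ m)))‖ ≤
      C * D * ν * Real.exp (-(n * ‖latticePt m‖)) := by
    calc _ ≤ C * Real.exp (s * ‖latticePt m‖) *
            (D * (ν * Real.exp (-(k * ‖latticePt m‖)))) := hfC _ _ _ (hpiece φ m)
      _ = C * D * ν * Real.exp (s * ‖latticePt m‖ + -(k * ‖latticePt m‖)) := by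
          rw [Real.exp_add]; ring
      _ ≤ C * D * ν * Real.exp (-(n * ‖latticePt m‖)) := by
          gcongr
          nlinarith [norm_nonneg (latticePt m)]
  calc ‖f φ‖ ≤ ∑ m ∈ Fintype.piFinset fun _ : Fin n => S,
        C * D * ν * Real.exp (-(n * ‖latticePt m‖)) := by
        rw [← hS, map_sum]
        exact norm_sum_le_of_le _ fun m _ => hS.symm ▸ hterm m
    _ ≤ C * D * ν * Z := by
        rw [← Finset.mul_sum]
        gcongr
        exact sum_exp_neg_norm_latticePt_le n S
    _ = C * D * Z * ν := by ring

end Lattice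

section WeightedSobolev

variable {n : ℕ}

namespace Weight

variable (ω : Weight n) {F : Type*} [NormedAddCommGroup F] [NormedSpace ℝ F]

theorem integrable_iff {g : Rn n → F} :
    Integrable g ω.measure ↔ Integrable fun t => ω t • g t := by
  rw [Weight.measure,
    integrable_withDensity_iff_integrable_smul' ω.measurable'.ennreal_ofReal (by simp)]
  simp only [ENNReal.toReal_ofReal (ω.pos' _).le]

theorem integral_eq (g : Rn n → F) : ∫ t, g t ∂ω.measure = ∫ t, ω t • g t := by
  rw [Weight.measure,
    integral_withDensity_eq_integral_toReal_smul ω.measurable'.ennreal_ofReal (by simp)]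
  simp only [ENNReal.toReal_ofReal (ω.pos' _).le]

theorem exists_integrable_exp :
    ∃ k : ℕ, Integrable (fun t => Real.exp (-(k * ‖t‖))) ω.measure := by
  obtain ⟨A, a, hA, -, moderate⟩ := ω.moderate'
  obtain ⟨k, hk⟩ := exists_nat_ge (a + 1)
  have hω₀ := ω.pos' 0
  refine ⟨k, ω.integrable_iff.2 (((integrable_exp_neg_norm volume).const_mul (A * ω 0)).mono'
    (ω.measurable'.smul (by fun_prop)).aestronglyMeasurable (ae_of_all _ fun t => ?_))⟩
  rw [norm_smul, Real.norm_of_nonneg (ω.pos' t).le, Real.norm_of_nonneg (Real.exp_pos _).le]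
  calc ω t * Real.exp (-(k * ‖t‖))
      ≤ A * ω 0 * Real.exp (a * ‖t‖) * Real.exp (-(k * ‖t‖)) := by
        gcongr
        simpa using moderate t 0
    _ = A * ω 0 * Real.exp (a * ‖t‖ - k * ‖t‖) := by rw [mul_assoc, ← Real.exp_add, sub_eq_add_neg]
    _ ≤ A * ω 0 * Real.exp (-‖t‖) := by
        gcongr
        nlinarith [norm_nonneg t]

theorem exists_le_mul_of_dist_le (r : ℝ) :
    ∃ C, 0 ≤ C ∧ ∀ x y, dist x y ≤ r → ω x ≤ C * ω y := by
  obtain ⟨A, a, hA, ha, moderate⟩ := ω.moderate'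
  refine ⟨A * Real.exp (a * r), by positivity, fun x y hxy => ?_⟩
  have hω := ω.pos' y
  calc ω x = ω (x - y + y) := by rw [sub_add_cancel]
    _ ≤ A * ω y * Real.exp (a * ‖x - y‖) := moderate (x - y) y
    _ ≤ A * ω y * Real.exp (a * r) := by
        rw [← dist_eq_norm]
        gcongr
    _ = A * Real.exp (a * r) * ω y := by ring

end Weight

namespace K1

theorem integrable_iteratedFDeriv (φ : K1 n) (ω : Weight n) (j : ℕ) :
    Integrable (iteratedFDeriv ℝ j φ) ω.measure := by
  obtain ⟨k, hk⟩ := ω.exists_integrable_exp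
  refine (hk.const_mul (nu n (max k j) φ)).mono'
    (φ.2.1.continuous_iteratedFDeriv (mod_cast le_top)).aestronglyMeasurable
    (ae_of_all _ fun t => (norm_iteratedFDeriv_le_nu (le_max_right k j) φ t).trans ?_)
  gcongr
  exact le_max_left k j

/-- The inclusion of `K₁(ℝⁿ)` in `D_{L¹_ω}(ℝⁿ)` as a linear map. -/
def toDL1ₗ (ω : Weight n) : K1 n →ₗ[ℂ] DL1 ω where
  toFun φ := ⟨φ.1, φ.2.1, φ.integrable_iteratedFDeriv ω⟩
  map_add' _ _ := rfl
  map_smul' _ _ := rfl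

theorem continuous_toDL1ₗ (ω : Weight n) : Continuous (toDL1ₗ ω) := by
  obtain ⟨k, hk⟩ := ω.exists_integrable_exp
  refine (withSeminorms n).continuous_of_isBounded (DL1.withSeminorms ω) (toDL1ₗ ω) fun i =>
    ⟨{max k i}, ⟨∫ t, Real.exp (-(k * ‖t‖)) ∂ω.measure, by positivity⟩, fun φ => ?_⟩
  rw [Finset.sup_singleton]
  refine Seminorm.finset_sup_apply_le (by positivity) fun j hj => ?_
  calc ∫ t, ‖iteratedFDeriv ℝ j φ t‖ ∂ω.measure
      ≤ ∫ t, nu n (max k i) φ * Real.exp (-(k * ‖t‖)) ∂ω.measure := by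
        refine integral_mono (φ.integrable_iteratedFDeriv ω j).norm (hk.const_mul _) fun t => ?_
        refine (norm_iteratedFDeriv_le_nu
          ((Finset.mem_range_succ_iff.1 hj).trans (le_max_right k i)) φ t).trans ?_
        gcongr
        exact le_max_left k i
    _ = (∫ t, Real.exp (-(k * ‖t‖)) ∂ω.measure) * nu n (max k i) φ := by
        rw [integral_const_mul, mul_comm]

end K1

theorem BDual_subset_K1Dual (ω : Weight n) : BDual ω ⊆ K1Dual n := by
  rintro f ⟨F, hF⟩
  exact ⟨F.comp ⟨K1.toDL1ₗ ω, K1.continuous_toDL1ₗ ω⟩, hF⟩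

theorem BDotDual_subset_BDual (ω : Weight n) : BDotDual ω ⊆ BDual ω :=
  fun _ ⟨F, _, hF⟩ => ⟨F, hF⟩

namespace DL1

variable {ω : Weight n}

theorem weightedInt_le_norms {k j : ℕ} (hj : j ≤ k) (χ : DL1 ω) :
    weightedInt ω j χ ≤ norms ω k χ :=
  Seminorm.le_finset_sup_apply (p := fun j => weightedInt ω j) (Finset.mem_range_succ_iff.2 hj)

theorem weightedInt_apply (j : ℕ) (χ : DL1 ω) :
    weightedInt ω j χ = ∫ t, ω t * ‖iteratedFDeriv ℝ j χ t‖ :=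
  ω.integral_eq fun t => ‖iteratedFDeriv ℝ j χ t‖

theorem integrable_weight_mul_norm_iteratedFDeriv (χ : DL1 ω) (j : ℕ) :
    Integrable fun t => ω t * ‖iteratedFDeriv ℝ j χ t‖ :=
  ω.integrable_iff.1 (χ.2.2 j).norm

theorem weight_mul_setIntegral_norm_le {C r : ℝ} {t : Rn n}
    (hC : ∀ x ∈ Metric.closedBall t r, ω t ≤ C * ω x) (χ : DL1 ω) (i : ℕ) :
    ω t * ∫ x in Metric.closedBall t r, ‖iteratedFDeriv ℝ i χ x‖ ≤
      C * ∫ x in Metric.closedBall t r, ω x * ‖iteratedFDeriv ℝ i χ x‖ := by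
  have hint : IntegrableOn (fun x => ‖iteratedFDeriv ℝ i χ x‖) (Metric.closedBall t r) :=
    (χ.2.1.continuous_iteratedFDeriv (mod_cast le_top)).norm.continuousOn.integrableOn_compact
      (isCompact_closedBall t r)
  rw [← integral_const_mul, ← integral_const_mul]
  refine setIntegral_mono_on (hint.const_mul _)
    ((χ.integrable_weight_mul_norm_iteratedFDeriv i).integrableOn.const_mul _)
    measurableSet_closedBall fun x hx => ?_
  rw [← mul_assoc]
  gcongr
  exact hC x hx

theorem exists_weight_mul_norm_iteratedFDeriv_le_sum_setIntegral (ω : Weight n) (j : ℕ) :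
    ∃ C, 0 ≤ C ∧ ∀ (χ : DL1 ω) (t : Rn n), ω t * ‖iteratedFDeriv ℝ j χ t‖ ≤
      C * ∑ i ∈ Finset.range (j + (n + 2)),
        ∫ x in Metric.closedBall t 2, ω x * ‖iteratedFDeriv ℝ i χ x‖ := by
  obtain ⟨C₁, hC₁, sobolev⟩ :=
    exists_norm_le_sum_setIntegral_iteratedFDeriv (Rn n) (Rn n [×j]→L[ℝ] ℂ)
  obtain ⟨C₂, hC₂, hω⟩ := ω.exists_le_mul_of_dist_le 2
  refine ⟨C₁ * C₂, by positivity, fun χ t => ?_⟩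
  have hsob : ‖iteratedFDeriv ℝ j χ t‖ ≤ C₁ * ∑ i ∈ Finset.range (n + 2),
      ∫ x in Metric.closedBall t 2, ‖iteratedFDeriv ℝ (j + i) χ x‖ := by
    simpa only [norm_iteratedFDeriv_iteratedFDeriv, finrank_euclideanSpace_fin] using
      sobolev (iteratedFDeriv ℝ j χ) (χ.2.1.iteratedFDeriv_right (mod_cast le_top)) t
  have hball : ∀ x ∈ Metric.closedBall t 2, ω t ≤ C₂ * ω x := fun x hx =>
    hω t x (Metric.mem_closedBall'.1 hx)
  have hnonneg (i : ℕ) : 0 ≤ ∫ x in Metric.closedBall t 2, ω x * ‖iteratedFDeriv ℝ i χ x‖ :=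
    integral_nonneg fun x => mul_nonneg (ω.pos' x).le (norm_nonneg _)
  calc ω t * ‖iteratedFDeriv ℝ j χ t‖
      ≤ ω t * (C₁ * ∑ i ∈ Finset.range (n + 2),
          ∫ x in Metric.closedBall t 2, ‖iteratedFDeriv ℝ (j + i) χ x‖) :=
        mul_le_mul_of_nonneg_left hsob (ω.pos' t).le
    _ = C₁ * ∑ i ∈ Finset.range (n + 2),
          ω t * ∫ x in Metric.closedBall t 2, ‖iteratedFDeriv ℝ (j + i) χ x‖ := by
        rw [mul_left_comm, Finset.mul_sum]
    _ ≤ C₁ * ∑ i ∈ Finset.range (n + 2),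
          C₂ * ∫ x in Metric.closedBall t 2, ω x * ‖iteratedFDeriv ℝ (j + i) χ x‖ := by
        refine mul_le_mul_of_nonneg_left (Finset.sum_le_sum fun i _ => ?_) hC₁
        exact weight_mul_setIntegral_norm_le hball χ (j + i)
    _ ≤ C₁ * C₂ * ∑ i ∈ Finset.range (j + (n + 2)),
          ∫ x in Metric.closedBall t 2, ω x * ‖iteratedFDeriv ℝ i χ x‖ := by
        rw [← Finset.mul_sum, ← mul_assoc, Finset.sum_range_add _ j (n + 2)]
        refine mul_le_mul_of_nonneg_left ?_ (by positivity)
        exact le_add_of_nonneg_left (Finset.sum_nonneg fun i _ => hnonneg i)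

theorem exists_weight_mul_norm_iteratedFDeriv_le_norms (ω : Weight n) (j : ℕ) :
    ∃ C, 0 ≤ C ∧ ∀ (χ : DL1 ω) (t : Rn n),
      ω t * ‖iteratedFDeriv ℝ j χ t‖ ≤ C * norms ω (j + n + 1) χ := by
  obtain ⟨C, hC, sobolev⟩ := exists_weight_mul_norm_iteratedFDeriv_le_sum_setIntegral ω j
  refine ⟨C * (j + n + 2 : ℕ), by positivity, fun χ t => (sobolev χ t).trans ?_⟩
  rw [mul_assoc, ← nsmul_eq_mul]
  refine mul_le_mul_of_nonneg_left ?_ hC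
  refine (Finset.sum_le_card_nsmul _ _ _ fun i hi => ?_).trans_eq (by rw [Finset.card_range]; rfl)
  calc ∫ x in Metric.closedBall t 2, ω x * ‖iteratedFDeriv ℝ i χ x‖
      ≤ ∫ x, ω x * ‖iteratedFDeriv ℝ i χ x‖ :=
        setIntegral_le_integral (χ.integrable_weight_mul_norm_iteratedFDeriv i)
          (ae_of_all _ fun x => mul_nonneg (ω.pos' x).le (norm_nonneg _))
    _ = weightedInt ω i χ := (weightedInt_apply i χ).symm
    _ ≤ norms ω (j + n + 1) χ := weightedInt_le_norms (Finset.mem_range_succ_iff.1 hi) χ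

end DL1

end WeightedSobolev

section SquareIntegrable

variable {X E : Type*} [MeasurableSpace X] {μ : Measure X} [NormedAddCommGroup E] {g : X → E}

theorem memLp_two_of_integrable_of_norm_le {M : ℝ} (hg : Integrable g μ)
    (hM : ∀ᵐ x ∂μ, ‖g x‖ ≤ M) : MemLp g 2 μ :=
  (memLp_two_iff_integrable_sq_norm hg.1).2 <| (hg.norm.const_mul M).mono' (hg.1.norm.pow 2) <|
    hM.mono fun x hx => by
      rw [norm_pow, norm_norm, sq]
      gcongr

theorem norm_toLp_two_sq_le_of_norm_le {M : ℝ} (h : MemLp g 2 μ) (hg : Integrable g μ)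
    (hM : ∀ᵐ x ∂μ, ‖g x‖ ≤ M) : ‖h.toLp g‖ ^ 2 ≤ M * ∫ x, ‖g x‖ ∂μ := by
  have hnorm : ‖h.toLp g‖ = √(∫ x, ‖g x‖ ^ 2 ∂μ) := by
    rw [Lp.norm_toLp, toReal_eLpNorm hg.1,
      lpNorm_eq_integral_norm_rpow_toReal two_ne_zero ENNReal.ofNat_ne_top hg.1, Real.sqrt_eq_rpow]
    norm_num only [ENNReal.toReal_ofNat, Real.rpow_ofNat]
  rw [hnorm, Real.sq_sqrt (by positivity), ← integral_const_mul]
  refine integral_mono_ae ((memLp_two_iff_integrable_sq_norm hg.1).1 h) (hg.norm.const_mul M)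
    (hM.mono fun x hx => ?_)
  dsimp only
  rw [sq]
  gcongr

theorem setIntegral_norm_le_sqrt_mul_norm (g : Lp E 2 μ) {s : Set X} (hs : μ s ≠ ⊤) :
    ∫ x in s, ‖g x‖ ∂μ ≤ √(μ.real s) * ‖g‖ := by
  have hg : AEStronglyMeasurable g (μ.restrict s) := (Lp.aestronglyMeasurable g).restrict
  have hle : eLpNorm g 1 (μ.restrict s) ≤ eLpNorm g 2 μ * μ s ^ (1 / 2 : ℝ) := by
    have hexp : 1 / (1 : ENNReal).toReal - 1 / (2 : ENNReal).toReal = 1 / 2 := by norm_num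
    refine (eLpNorm_le_eLpNorm_mul_rpow_measure_univ one_le_two hg).trans ?_
    rw [Measure.restrict_apply_univ, hexp]
    gcongr
    exact Measure.restrict_le_self
  have hfin : eLpNorm g 2 μ * μ s ^ (1 / 2 : ℝ) ≠ ⊤ :=
    ENNReal.mul_ne_top (Lp.memLp g).eLpNorm_ne_top (ENNReal.rpow_ne_top_of_nonneg (by simp) hs)
  rw [← lpNorm_one_eq_integral_norm hg, ← toReal_eLpNorm hg, Lp.norm_def, mul_comm,
    Real.sqrt_eq_rpow, Measure.real, ENNReal.toReal_rpow, ← ENNReal.toReal_mul]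
  exact ENNReal.toReal_mono hfin hle

end SquareIntegrable

theorem norm_le_sum_norm_apply_basis {𝕜 ι E F : Type*} [RCLike 𝕜] [Fintype ι]
    [NormedAddCommGroup E] [InnerProductSpace 𝕜 E] [NormedAddCommGroup F] [NormedSpace 𝕜 F]
    (b : OrthonormalBasis ι 𝕜 E) {j : ℕ} (M : E [×j]→L[𝕜] F) :
    ‖M‖ ≤ ∑ v : Fin j → ι, ‖M fun i => b (v i)‖ := by
  classical
  refine ContinuousMultilinearMap.opNorm_le_bound (by positivity) fun m => ?_
  have expand : M m = ∑ v : Fin j → ι, (∏ i, b.repr (m i) (v i)) • M fun i => b (v i) := by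
    conv_lhs => rw [← funext fun i => b.sum_repr (m i)]
    simp only [ContinuousMultilinearMap.map_sum, ContinuousMultilinearMap.map_smul_univ]
  rw [expand, Finset.sum_mul]
  refine (norm_sum_le _ _).trans (Finset.sum_le_sum fun v _ => ?_)
  rw [norm_smul, mul_comm, norm_prod]
  gcongr with i
  exact (PiLp.norm_apply_le _ _).trans_eq (b.repr.norm_map (m i))

section HahnBanach

theorem exists_strongDual_apply_eq_of_norm_le {𝕜 V E : Type*} [RCLike 𝕜] [AddCommGroup V]
    [Module 𝕜 V] [NormedAddCommGroup E] [NormedSpace 𝕜 E] (T : V →ₗ[𝕜] E) (f : V →ₗ[𝕜] 𝕜) (C : ℝ)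
    (hf : ∀ v, ‖f v‖ ≤ C * ‖T v‖) : ∃ G : StrongDual 𝕜 E, ∀ v, G (T v) = f v := by
  obtain ⟨g, hg⟩ : f ∈ LinearMap.range T.dualMap := by
    rw [LinearMap.range_dualMap_eq_dualAnnihilator_ker, Submodule.mem_dualAnnihilator]
    intro v hv
    simpa [LinearMap.mem_ker.1 hv] using hf v
  have hgT (v : V) : g (T v) = f v := LinearMap.congr_fun hg v
  let G₀ : StrongDual 𝕜 (LinearMap.range T) :=
    (g ∘ₗ (LinearMap.range T).subtype).mkContinuous C fun ⟨_, v, hv⟩ => by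
      subst hv
      exact (congrArg norm (hgT v)).trans_le (hf v)
  obtain ⟨G, hG, -⟩ := exists_extension_norm_eq (LinearMap.range T) G₀
  exact ⟨G, fun v => (hG ⟨T v, v, rfl⟩).trans (hgT v)⟩

/-- The real functional `(v, w) ↦ Re (f v + i f w)` is the real part of the functional sought. -/
theorem exists_strongDual_apply_eq_of_norm_le_norm_add_I_smul {V E : Type*} [AddCommGroup V]
    [Module ℝ V] [NormedAddCommGroup E] [NormedSpace ℂ E] (T : V →ₗ[ℝ] E) (f : V →ₗ[ℝ] ℂ) (C : ℝ)
    (hf : ∀ v w, ‖f v‖ ≤ C * ‖T v + Complex.I • T w‖) :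
    ∃ G : StrongDual ℂ E, ∀ v, G (T v) = f v := by
  let S : V × V →ₗ[ℝ] E := T.coprod (Complex.I • T)
  let u : V × V →ₗ[ℝ] ℝ := (Complex.reLm ∘ₗ f).coprod (-(Complex.imLm ∘ₗ f))
  have hf' (v w : V) : ‖f w‖ ≤ C * ‖T v + Complex.I • T w‖ := by
    have hrot : T w + Complex.I • T (-v) = -Complex.I • (T v + Complex.I • T w) := by
      rw [smul_add, smul_smul, map_neg, smul_neg, neg_smul, neg_mul, Complex.I_mul_I, neg_neg,
        one_smul, add_comm]
    exact (hf w (-v)).trans_eq (by rw [hrot, norm_smul, norm_neg, Complex.norm_I, one_mul])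
  have hu (p : V × V) : ‖u p‖ ≤ 2 * C * ‖S p‖ :=
    calc ‖u p‖ = ‖(f p.1).re - (f p.2).im‖ := by simp [u, sub_eq_add_neg]
      _ ≤ ‖f p.1‖ + ‖f p.2‖ := (norm_sub_le _ _).trans
          (add_le_add (Complex.abs_re_le_norm _) (Complex.abs_im_le_norm _))
      _ ≤ C * ‖S p‖ + C * ‖S p‖ := add_le_add (hf p.1 p.2) (hf' p.1 p.2)
      _ = 2 * C * ‖S p‖ := by ring
  obtain ⟨G₀, hG₀⟩ := exists_strongDual_apply_eq_of_norm_le S u (2 * C) hu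
  have hre (v : V) : G₀ (T v) = (f v).re := by simpa [S, u] using hG₀ (v, 0)
  have him (v : V) : G₀ (Complex.I • T v) = -(f v).im := by simpa [S, u] using hG₀ (0, v)
  refine ⟨G₀.extendRCLike, fun v => ?_⟩
  rw [StrongDual.extendRCLike_apply, RCLike.I_to_complex, hre, him]
  apply Complex.ext <;> simp

end HahnBanach

namespace DL1

variable {n : ℕ} {ω : Weight n} {j : ℕ}

theorem norm_weight_smul_iteratedFDeriv_apply_le (χ : DL1 ω) (v : Fin j → Rn n) (t : Rn n) :
    ‖ω t • iteratedFDeriv ℝ j χ t v‖ ≤ (∏ i, ‖v i‖) * (ω t * ‖iteratedFDeriv ℝ j χ t‖) := by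
  rw [norm_smul, Real.norm_of_nonneg (ω.pos' t).le, mul_left_comm, mul_comm (∏ i, ‖v i‖)]
  exact mul_le_mul_of_nonneg_left (ContinuousMultilinearMap.le_opNorm _ _) (ω.pos' t).le

theorem integrable_weight_smul_iteratedFDeriv_apply (χ : DL1 ω) (v : Fin j → Rn n) :
    Integrable fun t => ω t • iteratedFDeriv ℝ j χ t v :=
  ω.integrable_iff.1 <|
    (ContinuousMultilinearMap.apply ℝ (fun _ : Fin j => Rn n) ℂ v).integrable_comp (χ.2.2 j)

theorem exists_norm_weight_smul_iteratedFDeriv_apply_le_norms (ω : Weight n) (v : Fin j → Rn n) :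
    ∃ C, 0 ≤ C ∧ ∀ (χ : DL1 ω) (t : Rn n),
      ‖ω t • iteratedFDeriv ℝ j χ t v‖ ≤ C * norms ω (j + n + 1) χ := by
  obtain ⟨C, hC, hle⟩ := exists_weight_mul_norm_iteratedFDeriv_le_norms ω j
  refine ⟨(∏ i, ‖v i‖) * C, by positivity, fun χ t => ?_⟩
  rw [mul_assoc]
  exact (χ.norm_weight_smul_iteratedFDeriv_apply_le v t).trans
    (mul_le_mul_of_nonneg_left (hle χ t) (by positivity))

theorem memLp_two_weight_smul_iteratedFDeriv_apply (χ : DL1 ω) (v : Fin j → Rn n) :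
    MemLp (fun t => ω t • iteratedFDeriv ℝ j χ t v) 2 :=
  have ⟨_, _, hle⟩ := exists_norm_weight_smul_iteratedFDeriv_apply_le_norms ω v
  memLp_two_of_integrable_of_norm_le (χ.integrable_weight_smul_iteratedFDeriv_apply v)
    (ae_of_all _ (hle χ))

/-- The map `χ ↦ ω D^j χ(v₁, …, v_j)` from `D_{L¹_ω}(ℝⁿ)` to `L²(ℝⁿ)` as a linear map. -/
noncomputable def weightedDerivₗ (ω : Weight n) (v : Fin j → Rn n) :
    DL1 ω →ₗ[ℂ] Lp ℂ 2 (volume : Measure (Rn n)) where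
  toFun χ := (χ.memLp_two_weight_smul_iteratedFDeriv_apply v).toLp _
  map_add' φ χ := by
    rw [← MemLp.toLp_add]
    congr 1
    ext t
    have hadd : iteratedFDeriv ℝ j (φ + χ : DL1 ω) t =
        iteratedFDeriv ℝ j φ t + iteratedFDeriv ℝ j χ t :=
      iteratedFDeriv_add_apply (φ.2.1.of_le (mod_cast le_top)).contDiffAt
        (χ.2.1.of_le (mod_cast le_top)).contDiffAt
    simp only [hadd, Pi.add_apply, add_apply, smul_add]
  map_smul' c χ := by
    rw [RingHom.id_apply, ← MemLp.toLp_const_smul]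
    congr 1
    ext t
    have hsmul : iteratedFDeriv ℝ j (c • χ : DL1 ω) t = c • iteratedFDeriv ℝ j χ t :=
      iteratedFDeriv_const_smul_apply (χ.2.1.of_le (mod_cast le_top)).contDiffAt
    simp only [hsmul, Pi.smul_apply, smul_apply, smul_comm c]

theorem coeFn_weightedDerivₗ (v : Fin j → Rn n) (χ : DL1 ω) :
    weightedDerivₗ ω v χ =ᵐ[volume] fun t => ω t • iteratedFDeriv ℝ j χ t v :=
  (χ.memLp_two_weight_smul_iteratedFDeriv_apply v).coeFn_toLp

theorem exists_norm_weightedDerivₗ_le_norms (ω : Weight n) (v : Fin j → Rn n) :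
    ∃ C, 0 ≤ C ∧ ∀ χ : DL1 ω, ‖weightedDerivₗ ω v χ‖ ≤ C * norms ω (j + n + 1) χ := by
  obtain ⟨C, hC, hle⟩ := exists_norm_weight_smul_iteratedFDeriv_apply_le_norms ω v
  refine ⟨√(C * ∏ i, ‖v i‖), by positivity, fun χ => ?_⟩
  have : 0 ≤ norms ω (j + n + 1) χ := apply_nonneg _ _
  have hL1 : ∫ t, ‖ω t • iteratedFDeriv ℝ j χ t v‖ ≤ (∏ i, ‖v i‖) * norms ω (j + n + 1) χ :=
    calc ∫ t, ‖ω t • iteratedFDeriv ℝ j χ t v‖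
        ≤ ∫ t, (∏ i, ‖v i‖) * (ω t * ‖iteratedFDeriv ℝ j χ t‖) :=
          integral_mono (χ.integrable_weight_smul_iteratedFDeriv_apply v).norm
            ((χ.integrable_weight_mul_norm_iteratedFDeriv j).const_mul _)
            (χ.norm_weight_smul_iteratedFDeriv_apply_le v)
      _ = (∏ i, ‖v i‖) * weightedInt ω j χ := by rw [integral_const_mul, weightedInt_apply]
      _ ≤ (∏ i, ‖v i‖) * norms ω (j + n + 1) χ := by
          gcongr
          exact weightedInt_le_norms (by omega) χ
  refine le_of_sq_le_sq ?_ (by positivity)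
  calc ‖weightedDerivₗ ω v χ‖ ^ 2
      ≤ C * norms ω (j + n + 1) χ * ∫ t, ‖ω t • iteratedFDeriv ℝ j χ t v‖ :=
        norm_toLp_two_sq_le_of_norm_le (χ.memLp_two_weight_smul_iteratedFDeriv_apply v)
          (χ.integrable_weight_smul_iteratedFDeriv_apply v) (ae_of_all _ (hle χ))
    _ ≤ C * norms ω (j + n + 1) χ * ((∏ i, ‖v i‖) * norms ω (j + n + 1) χ) := by gcongr
    _ = (√(C * ∏ i, ‖v i‖) * norms ω (j + n + 1) χ) ^ 2 := by
        rw [mul_pow, Real.sq_sqrt (by positivity)]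
        ring

theorem continuous_weightedDerivₗ (ω : Weight n) (v : Fin j → Rn n) :
    Continuous (weightedDerivₗ ω v) := by
  obtain ⟨C, hC, hle⟩ := exists_norm_weightedDerivₗ_le_norms ω v
  refine (withSeminorms ω).continuous_of_isBounded (norm_withSeminorms ℂ _) (weightedDerivₗ ω v)
    fun _ => ⟨{j + n + 1}, ⟨C, hC⟩, fun χ => ?_⟩
  rw [Finset.sup_singleton]
  exact hle χ

/-- The map `χ ↦ ω D^j χ(v₁, …, v_j)` from `D_{L¹_ω}(ℝⁿ)` to `L²(ℝⁿ)` as a continuous linear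
map. -/
noncomputable def weightedDeriv (ω : Weight n) (v : Fin j → Rn n) :
    DL1 ω →L[ℂ] Lp ℂ 2 (volume : Measure (Rn n)) :=
  ⟨weightedDerivₗ ω v, continuous_weightedDerivₗ ω v⟩

/-- The coordinate directions of all partial derivatives of order less than `N`. -/
abbrev JetIndex (n N : ℕ) : Type := Σ j : Fin N, Fin j → Fin n

/-- All weighted partial derivatives of order less than `N`, as a single map to a power of
`L²(ℝⁿ)`. -/
noncomputable def jet (ω : Weight n) (N : ℕ) :
    DL1 ω →L[ℂ] (JetIndex n N → Lp ℂ 2 (volume : Measure (Rn n))) :=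
  ContinuousLinearMap.pi fun α => weightedDeriv ω fun i => EuclideanSpace.basisFun (Fin n) ℝ (α.2 i)

theorem setIntegral_weight_mul_norm_iteratedFDeriv_le_norm_jet {N : ℕ} (hj : j < N) (χ : DL1 ω)
    {s : Set (Rn n)} (hs : volume s ≠ ⊤) :
    ∫ x in s, ω x * ‖iteratedFDeriv ℝ j χ x‖ ≤
      √(volume.real s) * (n ^ j * ‖jet ω N χ‖) := by
  set e := EuclideanSpace.basisFun (Fin n) ℝ
  have hint (v : Fin j → Fin n) :
      IntegrableOn (fun x => ‖ω x • iteratedFDeriv ℝ j χ x fun i => e (v i)‖) s :=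
    (χ.integrable_weight_smul_iteratedFDeriv_apply _).norm.integrableOn
  have hL2 (v : Fin j → Fin n) : ∫ x in s, ‖ω x • iteratedFDeriv ℝ j χ x fun i => e (v i)‖ ≤
      √(volume.real s) * ‖jet ω N χ‖ :=
    calc ∫ x in s, ‖ω x • iteratedFDeriv ℝ j χ x fun i => e (v i)‖
        = ∫ x in s, ‖weightedDerivₗ ω (fun i => e (v i)) χ x‖ :=
          integral_congr_ae <| ae_restrict_of_ae <|
            (coeFn_weightedDerivₗ _ χ).mono fun x hx => (congrArg norm hx).symm
      _ ≤ √(volume.real s) * ‖weightedDerivₗ ω (fun i => e (v i)) χ‖ :=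
          setIntegral_norm_le_sqrt_mul_norm _ hs
      _ ≤ √(volume.real s) * ‖jet ω N χ‖ := by
          gcongr
          exact norm_le_pi_norm (jet ω N χ) ⟨⟨j, hj⟩, v⟩
  calc ∫ x in s, ω x * ‖iteratedFDeriv ℝ j χ x‖
      ≤ ∫ x in s, ∑ v : Fin j → Fin n, ‖ω x • iteratedFDeriv ℝ j χ x fun i => e (v i)‖ := by
        refine integral_mono (χ.integrable_weight_mul_norm_iteratedFDeriv j).integrableOn
          (integrable_finsetSum _ fun v _ => hint v) fun x => ?_
        simp only [norm_smul, Real.norm_of_nonneg (ω.pos' x).le, ← Finset.mul_sum]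
        exact mul_le_mul_of_nonneg_left (norm_le_sum_norm_apply_basis e _) (ω.pos' x).le
    _ = ∑ v : Fin j → Fin n, ∫ x in s, ‖ω x • iteratedFDeriv ℝ j χ x fun i => e (v i)‖ :=
        integral_finsetSum _ fun v _ => hint v
    _ ≤ ∑ _v : Fin j → Fin n, √(volume.real s) * ‖jet ω N χ‖ :=
        Finset.sum_le_sum fun v _ => hL2 v
    _ = √(volume.real s) * (n ^ j * ‖jet ω N χ‖) := by
        rw [Finset.sum_const, Finset.card_univ, Fintype.card_fun, Fintype.card_fin,
          Fintype.card_fin, nsmul_eq_mul, Nat.cast_pow, mul_left_comm]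

theorem exists_weight_mul_norm_iteratedFDeriv_le_norm_jet (ω : Weight n) (j : ℕ) :
    ∃ C, 0 ≤ C ∧ ∀ N, j + n + 2 ≤ N → ∀ (χ : DL1 ω) (t : Rn n),
      ω t * ‖iteratedFDeriv ℝ j χ t‖ ≤ C * ‖jet ω N χ‖ := by
  obtain ⟨C, hC, sobolev⟩ := exists_weight_mul_norm_iteratedFDeriv_le_sum_setIntegral ω j
  set V := volume.real (Metric.closedBall (0 : Rn n) 2)
  refine ⟨C * ∑ i ∈ Finset.range (j + (n + 2)), √V * n ^ i, by positivity,
    fun N hN χ t => (sobolev χ t).trans ?_⟩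
  rw [mul_assoc, Finset.sum_mul]
  refine mul_le_mul_of_nonneg_left (Finset.sum_le_sum fun i hi => ?_) hC
  have hi' : i < N := (Finset.mem_range.1 hi).trans_le hN
  refine (setIntegral_weight_mul_norm_iteratedFDeriv_le_norm_jet hi' χ
    (isCompact_closedBall t 2).measure_ne_top).trans_eq ?_
  rw [Measure.addHaar_real_closedBall_center, mul_assoc]

theorem exists_forall_weight_mul_norm_iteratedFDeriv_le_norm_jet (ω : Weight n) (k : ℕ) :
    ∃ C, 0 ≤ C ∧ ∀ j ≤ k, ∀ (χ : DL1 ω) (t : Rn n),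
      ω t * ‖iteratedFDeriv ℝ j χ t‖ ≤ C * ‖jet ω (k + n + 2) χ‖ := by
  choose C hC hle using exists_weight_mul_norm_iteratedFDeriv_le_norm_jet ω
  refine ⟨∑ j ∈ Finset.range (k + 1), C j, Finset.sum_nonneg fun j _ => hC j,
    fun j hj χ t => (hle j (k + n + 2) (by omega) χ t).trans ?_⟩
  gcongr
  exact Finset.single_le_sum (fun i _ => hC i) (Finset.mem_range_succ_iff.2 hj)

end DL1

theorem exists_integral_mul_iteratedFDeriv_eq {𝕜 V : Type*} [RCLike 𝕜] [NormedAddCommGroup V]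
    [NormedSpace ℝ V] [FiniteDimensional ℝ V] [MeasurableSpace V] [BorelSpace V] (μ : Measure V)
    [μ.IsAddHaarMeasure] {j : ℕ} (v : Fin j → V) {ψ : V → 𝕜} (hψ : ContDiff ℝ (⊤ : ℕ∞) ψ)
    (hψs : HasCompactSupport ψ) :
    ∃ φ : V → 𝕜, ContDiff ℝ (⊤ : ℕ∞) φ ∧ HasCompactSupport φ ∧ ∀ χ : V → 𝕜, ContDiff ℝ j χ →
      ∫ t, ψ t * iteratedFDeriv ℝ j χ t v ∂μ = ∫ t, φ t * χ t ∂μ := by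
  induction j generalizing ψ with
  | zero => exact ⟨ψ, hψ, hψs, fun χ _ => by simp only [iteratedFDeriv_zero_apply]⟩
  | succ j ih =>
    have hψ' : ContDiff ℝ (⊤ : ℕ∞) fun t => fderiv ℝ ψ t (v 0) :=
      (hψ.fderiv_right (mod_cast le_top)).clm_apply contDiff_const
    have hψs' : HasCompactSupport fun t => fderiv ℝ ψ t (v 0) := hψs.fderiv_apply (𝕜 := ℝ) (v 0)
    obtain ⟨φ, hφ, hφs, hint⟩ := ih (Fin.tail v) hψ'.neg hψs'.neg
    refine ⟨φ, hφ, hφs, fun χ hχ => ?_⟩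
    have hχj : ContDiff ℝ 1 (iteratedFDeriv ℝ j χ) :=
      hχ.iteratedFDeriv_right (by rw [add_comm]; norm_cast)
    set g : V → 𝕜 := fun t => iteratedFDeriv ℝ j χ t (Fin.tail v)
    have hg : ContDiff ℝ 1 g :=
      (ContinuousMultilinearMap.apply ℝ (fun _ : Fin j => V) 𝕜 (Fin.tail v)).contDiff.comp hχj
    have hg' : Continuous fun t => fderiv ℝ g t (v 0) :=
      (hg.continuous_fderiv one_ne_zero).clm_apply continuous_const
    calc ∫ t, ψ t * iteratedFDeriv ℝ (j + 1) χ t v ∂μ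
        = ∫ t, ψ t * fderiv ℝ g t (v 0) ∂μ := by
          simp only [(hχj.differentiable one_ne_zero _).iteratedFDeriv_succ_apply_left', g]
      _ = -∫ t, fderiv ℝ ψ t (v 0) * g t ∂μ :=
          integral_mul_fderiv_eq_neg_fderiv_mul_of_integrable
            ((hψ'.continuous.mul hg.continuous).integrable_of_hasCompactSupport hψs'.mul_right)
            ((hψ.continuous.mul hg').integrable_of_hasCompactSupport hψs.mul_right)
            ((hψ.continuous.mul hg.continuous).integrable_of_hasCompactSupport hψs.mul_right)
            (fun t _ => hψ.differentiable (by simp) t) (fun t _ => hg.differentiable (by simp) t)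
      _ = ∫ t, -fderiv ℝ ψ t (v 0) * g t ∂μ := by simp only [neg_mul, integral_neg]
      _ = ∫ t, φ t * χ t ∂μ := hint χ (hχ.of_le (by norm_cast; omega))

/-- The weight `t ↦ exp (k √(1 + |t|²))`, a smooth substitute for `t ↦ exp (k |t|)`. -/
noncomputable def expWeight (n k : ℕ) : Weight n where
  toFun t := Real.exp (k * √(1 + ‖t‖ ^ 2))
  measurable' := by fun_prop
  pos' _ := Real.exp_pos _
  moderate' := by
    refine ⟨Real.exp k, k, Real.exp_pos _, Nat.cast_nonneg _, fun x y => ?_⟩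
    have hsqrt : √(1 + ‖x + y‖ ^ 2) ≤ 1 + √(1 + ‖y‖ ^ 2) + ‖x‖ := by
      have hy : ‖y‖ ≤ √(1 + ‖y‖ ^ 2) := Real.le_sqrt_of_sq_le (by linarith)
      calc √(1 + ‖x + y‖ ^ 2) ≤ 1 + ‖x + y‖ :=
            Real.sqrt_le_iff.2 ⟨by positivity, by nlinarith [norm_nonneg (x + y)]⟩
        _ ≤ 1 + √(1 + ‖y‖ ^ 2) + ‖x‖ := by linarith [norm_add_le x y]
    rw [← Real.exp_add, ← Real.exp_add, Real.exp_le_exp]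
    calc k * √(1 + ‖x + y‖ ^ 2) ≤ k * (1 + √(1 + ‖y‖ ^ 2) + ‖x‖) := by gcongr
      _ = k + k * √(1 + ‖y‖ ^ 2) + k * ‖x‖ := by ring

theorem contDiff_expWeight (n k : ℕ) : ContDiff ℝ (⊤ : ℕ∞) (expWeight n k) :=
  (contDiff_const.mul ((contDiff_const.add (contDiff_norm_sq ℝ)).sqrt fun t => by positivity)).exp

theorem exp_mul_norm_le_expWeight {n : ℕ} (k : ℕ) (t : Rn n) :
    Real.exp (k * ‖t‖) ≤ expWeight n k t := by
  refine Real.exp_le_exp.2 (mul_le_mul_of_nonneg_left ?_ k.cast_nonneg)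
  exact Real.le_sqrt_of_sq_le (by linarith)

section Closure

variable {n : ℕ} {ω : Weight n}

theorem add_mem_testFunctionals {F G : DL1 ω →L[ℂ] ℂ} (hF : F ∈ testFunctionals ω)
    (hG : G ∈ testFunctionals ω) : F + G ∈ testFunctionals ω := by
  obtain ⟨φ, hφ⟩ := hF
  obtain ⟨ψ, hψ⟩ := hG
  refine ⟨φ + ψ, fun χ => ?_⟩
  have hint (θ : 𝓓((⊤ : Opens (Rn n)), ℂ)) : Integrable fun t => θ t * χ t :=
    (θ.continuous.mul χ.2.1.continuous).integrable_of_hasCompactSupport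
      θ.hasCompactSupport.mul_right
  rw [add_apply, hφ, hψ, ← integral_add (hint φ) (hint ψ)]
  exact integral_congr_ae (ae_of_all _ fun t => (add_mul (φ t) (ψ t) (χ t)).symm)

theorem sum_mem_closure_testFunctionals {ι : Type*} {s : Finset ι} {F : ι → DL1 ω →L[ℂ] ℂ}
    (hF : ∀ i ∈ s, F i ∈ closure (testFunctionals ω)) :
    ∑ i ∈ s, F i ∈ closure (testFunctionals ω) := by
  have := (DL1.withSeminorms ω).topologicalAddGroup
  let M : AddSubmonoid (DL1 ω →L[ℂ] ℂ) :=
    { carrier := testFunctionals ω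
      zero_mem' := ⟨0, fun χ => by simp⟩
      add_mem' := add_mem_testFunctionals }
  exact M.topologicalClosure.sum_mem hF

namespace DL1

theorem toDual_comp_weightedDeriv_mem_testFunctionals (hω : ContDiff ℝ (⊤ : ℕ∞) ω) {j : ℕ}
    (v : Fin j → Rn n) {g : Lp ℂ 2 (volume : Measure (Rn n))} {ψ : Rn n → ℂ}
    (hg : g =ᵐ[volume] ψ) (hψs : HasCompactSupport ψ) (hψ : ContDiff ℝ (⊤ : ℕ∞) ψ) :
    (InnerProductSpace.toDual ℂ _ g).comp (weightedDeriv ω v) ∈ testFunctionals ω := by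
  obtain ⟨φ, hφ, hφs, hint⟩ := exists_integral_mul_iteratedFDeriv_eq volume v
    (hω.smul (Complex.conjCLE.contDiff.comp hψ))
    (hψs.comp_left (map_zero (starRingEnd ℂ))).smul_left
  refine ⟨⟨φ, hφ, hφs, Set.subset_univ _⟩, fun χ => ?_⟩
  calc inner ℂ g (weightedDerivₗ ω v χ)
      = ∫ t, (ω t • (starRingEnd ℂ) (ψ t)) * iteratedFDeriv ℝ j χ t v := by
        rw [L2.inner_def]
        refine integral_congr_ae ?_
        filter_upwards [hg, coeFn_weightedDerivₗ v χ] with t hgt hχt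
        rw [hgt, hχt, RCLike.inner_apply', mul_smul_comm, smul_mul_assoc]
    _ = ∫ t, φ t * χ t := hint χ (χ.2.1.of_le (mod_cast le_top))

theorem comp_weightedDeriv_mem_closure_testFunctionals (hω : ContDiff ℝ (⊤ : ℕ∞) ω) {j : ℕ}
    (v : Fin j → Rn n) (G : StrongDual ℂ (Lp ℂ 2 (volume : Measure (Rn n)))) :
    G.comp (weightedDeriv ω v) ∈ closure (testFunctionals ω) := by
  have := (DL1.withSeminorms ω).topologicalAddGroup
  have := (DL1.withSeminorms ω).continuousSMul
  obtain ⟨g, rfl⟩ := (InnerProductSpace.toDual ℂ (Lp ℂ 2 (volume : Measure (Rn n)))).surjective G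
  let Φ : Lp ℂ 2 (volume : Measure (Rn n)) → DL1 ω →L[ℂ] ℂ := fun g =>
    (InnerProductSpace.toDual ℂ _ g).comp (weightedDeriv ω v)
  have hΦ : Continuous Φ := (ContinuousLinearMap.precomp ℂ (weightedDeriv ω v)).continuous.comp
    (InnerProductSpace.toDual ℂ _).continuous
  have hmem : Φ g ∈ closure (testFunctionals ω) :=
    map_mem_closure hΦ (Lp.dense_hasCompactSupport_contDiff ENNReal.ofNat_ne_top g)
      fun _ ⟨_, hg, hψs, hψ⟩ => toDual_comp_weightedDeriv_mem_testFunctionals hω v hg hψs hψ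
  exact hmem

theorem comp_jet_mem_closure_testFunctionals (hω : ContDiff ℝ (⊤ : ℕ∞) ω) {N : ℕ}
    (G : StrongDual ℂ (JetIndex n N → Lp ℂ 2 (volume : Measure (Rn n)))) :
    G.comp (jet ω N) ∈ closure (testFunctionals ω) := by
  classical
  have hsum : G.comp (jet ω N) = ∑ α : JetIndex n N,
      (G.comp (ContinuousLinearMap.single ℂ _ α)).comp
        (weightedDeriv ω fun i => EuclideanSpace.basisFun (Fin n) ℝ (α.2 i)) := by
    ext χ
    rw [sum_apply]
    calc G (jet ω N χ) = G (∑ α, Pi.single α (jet ω N χ α)) := by rw [Finset.univ_sum_single]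
      _ = ∑ α, G (Pi.single α (jet ω N χ α)) := map_sum G _ _
  rw [hsum]
  exact sum_mem_closure_testFunctionals fun α _ =>
    comp_weightedDeriv_mem_closure_testFunctionals hω _ _

/-- The inclusion of the real test functions in `D_{L¹_ω}(ℝⁿ)` as a linear map. -/
noncomputable def ofTestₗ (ω : Weight n) : 𝓓((⊤ : Opens (Rn n)), ℝ) →ₗ[ℝ] DL1 ω where
  toFun := ofTest ω
  map_add' φ ψ := Subtype.ext <| funext fun t => Complex.ofReal_add (φ t) (ψ t)
  map_smul' c φ := Subtype.ext <| funext fun t => Complex.ofReal_mul c (φ t)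

theorem norm_iteratedFDeriv_le_norm_iteratedFDeriv_ofTest_add_I_smul
    (φ ψ : 𝓓((⊤ : Opens (Rn n)), ℝ)) (j : ℕ) (t : Rn n) :
    ‖iteratedFDeriv ℝ j φ t‖ ≤
      ‖iteratedFDeriv ℝ j (ofTest ω φ + Complex.I • ofTest ω ψ : DL1 ω) t‖ := by
  set χ := ofTest ω φ + Complex.I • ofTest ω ψ
  have hre : (φ : Rn n → ℝ) = Complex.reCLM ∘ χ := by
    ext s
    change φ s = ((φ s : ℂ) + Complex.I * (ψ s : ℂ)).re
    simp
  have hχ : ContDiffAt ℝ j χ t := (χ.2.1.of_le (mod_cast le_top)).contDiffAt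
  simpa only [← hre, Complex.reCLM_norm, one_mul] using
    Complex.reCLM.norm_iteratedFDeriv_comp_left hχ le_rfl

end DL1

end Closure

theorem HasExpOrder.exists_norm_apply_le_norm_jet {n k : ℕ} {f : 𝓓'((⊤ : Opens (Rn n)), ℂ)}
    (hf : HasExpOrder f k) : ∃ C, ∀ φ ψ : 𝓓((⊤ : Opens (Rn n)), ℝ),
      ‖f φ‖ ≤ C * ‖DL1.jet (expWeight n k) (k + n + 2)
        (DL1.ofTest _ φ + Complex.I • DL1.ofTest _ ψ)‖ := by
  obtain ⟨C₁, hC₁, hfν⟩ := hf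
  obtain ⟨C₂, hC₂, sobolev⟩ :=
    DL1.exists_forall_weight_mul_norm_iteratedFDeriv_le_norm_jet (expWeight n k) k
  refine ⟨C₁ * C₂, fun φ ψ => (hfν φ).trans ?_⟩
  rw [mul_assoc]
  refine mul_le_mul_of_nonneg_left (K1.nu_le (by positivity) fun j hj t => ?_) hC₁
  rw [K1.norm_iteratedFDeriv_ofTest]
  refine le_trans ?_ (sobolev j hj _ t)
  exact mul_le_mul (exp_mul_norm_le_expWeight k t)
    (DL1.norm_iteratedFDeriv_le_norm_iteratedFDeriv_ofTest_add_I_smul φ ψ j t)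
    (norm_nonneg _) ((expWeight n k).pos' t).le

theorem HasExpOrder.mem_BDotDual {n k : ℕ} {f : 𝓓'((⊤ : Opens (Rn n)), ℂ)}
    (hf : HasExpOrder f k) : f ∈ BDotDual (expWeight n k) := by
  set ω := expWeight n k
  obtain ⟨C, hC⟩ := hf.exists_norm_apply_le_norm_jet
  let J := (DL1.jet ω (k + n + 2)).toLinearMap.restrictScalars ℝ ∘ₗ DL1.ofTestₗ ω
  obtain ⟨G, hG⟩ :=
    exists_strongDual_apply_eq_of_norm_le_norm_add_I_smul J f.toLinearMap C fun φ ψ => by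
      have := hC φ ψ
      rw [map_add, map_smul] at this
      exact this
  exact ⟨G.comp (DL1.jet ω (k + n + 2)),
    DL1.comp_jet_mem_closure_testFunctionals (contDiff_expWeight n k) G, hG⟩

end ExpType

theorem mainTheorem9 (n : ℕ) :
    (ExpType.K1Dual n = ⋃ ω : ExpType.Weight n, ExpType.BDual ω) ∧
    (ExpType.K1Dual n = ⋃ ω : ExpType.Weight n, ExpType.BDotDual ω) ∧
    ∀ f : 𝓓'((⊤ : Opens (ExpType.Rn n)), ℂ),
      f ∈ ExpType.K1Dual n ↔
        ∃ s : ℝ, IsVonNBounded ℝ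
          (Set.range fun h : ExpType.Rn n =>
            Real.exp (-s * ‖h‖) • ExpType.translate (-h) f) := by
  have dot_subset_dual : (⋃ ω : ExpType.Weight n, ExpType.BDotDual ω) ⊆ ⋃ ω, ExpType.BDual ω :=
    Set.iUnion_mono ExpType.BDotDual_subset_BDual
  have dual_subset_K1Dual : (⋃ ω : ExpType.Weight n, ExpType.BDual ω) ⊆ ExpType.K1Dual n :=
    Set.iUnion_subset ExpType.BDual_subset_K1Dual
  have mem_dot {f : 𝓓'((⊤ : Opens (ExpType.Rn n)), ℂ)} {k : ℕ} (hf : ExpType.HasExpOrder f k) :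
      f ∈ ⋃ ω : ExpType.Weight n, ExpType.BDotDual ω :=
    Set.mem_iUnion_of_mem _ hf.mem_BDotDual
  have K1Dual_subset_dot : ExpType.K1Dual n ⊆ ⋃ ω : ExpType.Weight n, ExpType.BDotDual ω :=
    fun _ hf => (ExpType.exists_hasExpOrder_of_mem_K1Dual hf).elim fun _ => mem_dot
  refine ⟨(K1Dual_subset_dot.trans dot_subset_dual).antisymm dual_subset_K1Dual,
    K1Dual_subset_dot.antisymm (dot_subset_dual.trans dual_subset_K1Dual),
    fun f => ⟨fun hf => ?_, fun ⟨s, hs⟩ => ?_⟩⟩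
  · obtain ⟨k, hk⟩ := ExpType.exists_hasExpOrder_of_mem_K1Dual hf
    exact ⟨k, hk.isVonNBounded_translates⟩
  · obtain ⟨k, hk⟩ := ExpType.exists_hasExpOrder_of_isVonNBounded hs
    exact dual_subset_K1Dual (dot_subset_dual (mem_dot hk))
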